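/- Let $2\le k\le n$ be integers and let $\Pi=\Pi_{n,k}$ be the lattice, ordered by refinement, of all partitions of $\{1,\dots,n\}$ each of whose blocks has either exactly one element (a trivial block) or at least $k$ elements (a non-trivial block). Its least element $0$ is the partition into singletons and its greatest element $1$ is the partition with one block. To $A\in\Pi$ corresponds the subspace of $\mathbf C^n$ that is the sum of the subspaces $V(\omega)=\{x:\sum_{i\in\omega}x_i=0,\ x_j=0\text{ for }j\notin\omega\}$ over all $k$-element subsets $\omega$ of blocks of $A$; $A\cap B$ denotes the intersection of the subspaces corresponding to $A$ and $B$. A one-block partition is an element of $\Pi$ with exactly one non-trivial block. For one-block partitions $A,B$ with non-trivial blocks $b_A,b_B$, the conditions $A\vee B=1$ and $A\cap B=0$ together mean that $b_A\cup b_B=\{1,\dots,n\}$ and $|b_A\cap b_B|=1$. For $A,B\in\Pi$ with $A\vee B=1$ let $\Pi_{A,B}$ be the subposet of $\Pi$ of all joins of sets of atoms of $\Pi$ each of which lies below $A$ or below $B$. For a commutative ring $R$ and an integer $p$, let $\tilde H_p(\Pi)$ and $\tilde H_p(\Pi_{A,B})$ be the reduced homology groups with coefficients in $R$ of the complexes of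 flags (finite chains) of the posets $\Pi\setminus\{0,1\}$ and $\Pi_{A,B}\setminus\{0,1\}$. Let $$\xi_p:\bigoplus_{\{A,B\}}\tilde H_p(\Pi_{A,B})\to\tilde H_p(\Pi)$$ be the homomorphism induced by the embeddings $\Pi_{A,B}\subseteq\Pi$, where $\{A,B\}$ runs over all sets of one-block partitions $A,B\in\Pi$ with $A\vee B=1$ and $A\cap B=0$. Then, for every $R$ and every integer $p<n-k-1$, the homomorphism $\xi_p$ is surjective. -/

import Mathlib

/-! ### Reduced homology of a poset, computed from its complex of flags -/

namespace PosetHomology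

/-- A flag of a poset `P`: a finite chain, possibly empty. A flag with `p + 1` elements is a
`p`-simplex of the flag complex; the empty flag is the simplex of dimension `-1` that gives the
augmentation. -/
def FinFlag (P : Type*) [PartialOrder P] : Type _ :=
  {s : Finset P // IsChain (· ≤ ·) (s : Set P)}

variable {P Q : Type*} [PartialOrder P] [PartialOrder Q]

open Classical in
/-- Remove an element from a flag. -/
noncomputable def FinFlag.erase (s : FinFlag P) (a : P) : FinFlag P :=
  ⟨s.1.erase a, s.2.mono (by simp)⟩

/-- The image of a flag under an order embedding. -/
def FinFlag.map (f : P ↪o Q) (s : FinFlag P) : FinFlag Q :=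
  ⟨s.1.map f.toEmbedding, by
    rw [Finset.coe_map]
    rintro _ ⟨a, ha, rfl⟩ _ ⟨b, hb, rfl⟩ _
    exact (s.2.total ha hb).imp (fun h => f.monotone h) fun h => f.monotone h⟩

variable (R : Type*) [CommRing R]

open Classical in
/-- The boundary operator on all flag chains:
`∂ (a₀ < ⋯ < aₚ) = ∑ i, (-1) ^ i • (a₀ < ⋯ < aᵢ₋₁ < aᵢ₊₁ < ⋯ < aₚ)`. -/
noncomputable def boundary (P : Type*) [PartialOrder P] :
    (FinFlag P →₀ R) →ₗ[R] (FinFlag P →₀ R) :=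
  Finsupp.linearCombination R fun s : FinFlag P =>
    ∑ a ∈ s.1, Finsupp.single (s.erase a) ((-1 : R) ^ (s.1.filter (· < a)).card)

/-- The chains of dimension `p`: combinations of flags with `p + 1` elements. -/
noncomputable def chains (P : Type*) [PartialOrder P] (p : ℤ) : Submodule R (FinFlag P →₀ R) :=
  Finsupp.supported R R {s : FinFlag P | (s.1.card : ℤ) = p + 1}

/-- The reduced cycles of dimension `p`. -/
noncomputable def cycles (P : Type*) [PartialOrder P] (p : ℤ) : Submodule R (FinFlag P →₀ R) :=
  chains R P p ⊓ LinearMap.ker (boundary R P)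

/-- The boundaries of dimension `p`. -/
noncomputable def boundaries (P : Type*) [PartialOrder P] (p : ℤ) :
    Submodule R (FinFlag P →₀ R) :=
  (chains R P (p + 1)).map (boundary R P)

set_option maxSynthPendingDepth 10 in
/-- The reduced homology `H̃ₚ(P; R)` of the poset `P`: reduced cycles modulo boundaries. -/
def RedHomology (P : Type*) [PartialOrder P] (p : ℤ) : Type _ :=
  cycles R P p ⧸ (boundaries R P p).submoduleOf (cycles R P p)

set_option maxSynthPendingDepth 10 in
noncomputable instance (P : Type*) [PartialOrder P] (p : ℤ) : AddCommGroup (RedHomology R P p) :=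
  inferInstanceAs (AddCommGroup (cycles R P p ⧸ (boundaries R P p).submoduleOf (cycles R P p)))

set_option maxSynthPendingDepth 10 in
noncomputable instance (P : Type*) [PartialOrder P] (p : ℤ) : Module R (RedHomology R P p) :=
  inferInstanceAs (Module R (cycles R P p ⧸ (boundaries R P p).submoduleOf (cycles R P p)))

/-- The map on flag chains induced by an order embedding. -/
noncomputable def chainMap (f : P ↪o Q) : (FinFlag P →₀ R) →ₗ[R] (FinFlag Q →₀ R) :=
  Finsupp.lmapDomain R R (FinFlag.map f)

theorem chainMap_boundary (f : P ↪o Q) (x : FinFlag P →₀ R) :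
    chainMap R f (boundary R P x) = boundary R Q (chainMap R f x) := by
  classical
  suffices h : chainMap R f ∘ₗ boundary R P = boundary R Q ∘ₗ chainMap R f from
    LinearMap.congr_fun h x
  refine Finsupp.lhom_ext' fun s => LinearMap.ext_ring ?_
  simp only [chainMap, boundary, LinearMap.comp_apply, Finsupp.lsingle_apply,
    Finsupp.lmapDomain_apply, Finsupp.mapDomain_single, Finsupp.linearCombination_single,
    one_smul, Finsupp.mapDomain_finsetSum]
  rw [show (FinFlag.map f s).1 = s.1.map f.toEmbedding from rfl, Finset.sum_map]
  refine Finset.sum_congr rfl fun a _ => ?_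
  congr 1
  · apply Subtype.ext
    simp only [FinFlag.map, FinFlag.erase]
    exact Finset.map_erase f.toEmbedding s.1 a
  · congr 1
    rw [Finset.filter_map, Finset.card_map]
    congr 1
    ext b
    simp

theorem chainMap_mem_chains (f : P ↪o Q) (p : ℤ) {x : FinFlag P →₀ R}
    (hx : x ∈ chains R P p) : chainMap R f x ∈ chains R Q p := by
  classical
  intro t ht
  obtain ⟨s, hs, rfl⟩ := Finset.mem_image.1 (Finsupp.mapDomain_support ht)
  have : (s.1.card : ℤ) = p + 1 := hx hs
  change ((s.1.map f.toEmbedding).card : ℤ) = p + 1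
  rwa [Finset.card_map]

/-- The map on reduced cycles induced by an order embedding. -/
noncomputable def cyclesMap (f : P ↪o Q) (p : ℤ) : cycles R P p →ₗ[R] cycles R Q p :=
  (chainMap R f).restrict fun x hx =>
    ⟨chainMap_mem_chains R f p hx.1, by
      change boundary R Q (chainMap R f x) = 0
      rw [← chainMap_boundary, LinearMap.mem_ker.1 hx.2, map_zero]⟩

set_option maxSynthPendingDepth 10 in
/-- The map on reduced homology induced by an order embedding. -/
noncomputable def redHomologyMap (f : P ↪o Q) (p : ℤ) :
    RedHomology R P p →ₗ[R] RedHomology R Q p :=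
  Submodule.mapQ ((boundaries R P p).submoduleOf (cycles R P p))
    ((boundaries R Q p).submoduleOf (cycles R Q p)) (cyclesMap R f p) (by
      rintro x ⟨y, hy, hyx⟩
      refine ⟨chainMap R f y, chainMap_mem_chains R f _ hy, ?_⟩
      rw [← chainMap_boundary, hyx]
      rfl)

end PosetHomology

/-! ### The lattices of partitions with forbidden small block sizes -/

namespace KEqual

open PosetHomology

/-- The partitions of an `n`-element set, each of whose blocks has exactly one element or at
least `k` elements. Partitions are equivalence relations, ordered by refinement: `r ≤ s` means
that every block of `r` lies in a block of `s`. -/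
def PiLattice (n k : ℕ) : Type :=
  {r : Setoid (Fin n) // ∀ b ∈ r.classes, b.ncard = 1 ∨ k ≤ b.ncard}

variable {n k : ℕ}

instance : PartialOrder (PiLattice n k) :=
  inferInstanceAs (PartialOrder {r : Setoid (Fin n) // ∀ b ∈ r.classes, b.ncard = 1 ∨ k ≤ b.ncard})

/-- The family is closed under joins of partitions. -/
theorem sSup_blocks (S : Set (PiLattice n k)) :
    ∀ b ∈ (sSup (Subtype.val '' S) : Setoid (Fin n)).classes, b.ncard = 1 ∨ k ≤ b.ncard := by
  rintro b ⟨x, rfl⟩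
  set j : Setoid (Fin n) := sSup (Subtype.val '' S) with hj
  by_cases h : ∃ r ∈ S, ∃ y, r.1 y x ∧ y ≠ x
  · obtain ⟨r, hr, y, hyx, hne⟩ := h
    right
    have hle : r.1 ≤ j := le_sSup ⟨r, hr, rfl⟩
    have hsub : {z | r.1 z x} ⊆ {z | j z x} := fun z hz => hle hz
    rcases r.2 _ ⟨x, rfl⟩ with h1 | hk
    · obtain ⟨w, hw⟩ := Set.ncard_eq_one.1 h1
      have hx : x ∈ {z | r.1 z x} := r.1.refl x
      have hy : y ∈ {z | r.1 z x} := hyx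
      rw [hw] at hx hy
      exact absurd (hy.trans hx.symm) hne
    · exact hk.trans (Set.ncard_le_ncard hsub (Set.toFinite _))
  · left
    push Not at h
    let t : Setoid (Fin n) :=
      ⟨fun y z => (y = x ↔ z = x), fun _ => Iff.rfl, fun h => h.symm, fun h h' => h.trans h'⟩
    have hle : j ≤ t := by
      refine sSup_le ?_
      rintro _ ⟨r, hr, rfl⟩ y z hyz
      change y = x ↔ z = x
      constructor
      · rintro rfl
        exact h r hr z (r.1.symm hyz)
      · rintro rfl
        exact h r hr y hyz
    refine Set.ncard_eq_one.2 ⟨x, Set.ext fun y => ⟨fun hy => ?_, ?_⟩⟩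
    · have h2 : y = x ↔ x = x := hle hy
      exact h2.2 rfl
    · rintro rfl
      exact j.refl _

/-- Joins in `PiLattice n k` are joins of partitions. -/
instance : SupSet (PiLattice n k) := ⟨fun S => ⟨sSup (Subtype.val '' S), sSup_blocks S⟩⟩

/-- The lattice structure for the refinement order. For `2 ≤ k ≤ n` its least element is the
partition into one-element sets and its greatest element is the partition with a single block. -/
instance : CompleteLattice (PiLattice n k) :=
  completeLatticeOfSup (PiLattice n k) fun S =>
    ⟨fun r hr => (le_sSup ⟨r, hr, rfl⟩ : r.1 ≤ sSup (Subtype.val '' S)), fun r hr =>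
      (sSup_le (by rintro _ ⟨s, hs, rfl⟩; exact hr hs) : sSup (Subtype.val '' S) ≤ r.1)⟩

/-- One-block partitions: those with exactly one non-trivial block. -/
def IsOneBlock (A : PiLattice n k) : Prop :=
  ∃! b : Set (Fin n), b ∈ A.1.classes ∧ b.ncard ≠ 1

/-- `V(ω) = {x ∈ ℂⁿ : ∑_{i ∈ ω} x_i = 0 and x_j = 0 for j ∉ ω}`. -/
def blockSubspace (ω : Finset (Fin n)) : Submodule ℂ (Fin n → ℂ) where
  carrier := {x | ∑ i ∈ ω, x i = 0 ∧ ∀ j ∉ ω, x j = 0}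
  zero_mem' := by simp
  add_mem' := by
    rintro x y ⟨hx, hx'⟩ ⟨hy, hy'⟩
    exact ⟨by simp [Finset.sum_add_distrib, hx, hy], fun j hj => by simp [hx' j hj, hy' j hj]⟩
  smul_mem' := by
    rintro c x ⟨hx, hx'⟩
    exact ⟨by simp [← Finset.mul_sum, hx], fun j hj => by simp [hx' j hj]⟩

/-- The subspace of `ℂⁿ` that corresponds to the partition `A`: the sum of all `V(ω)` where `ω`
is a `k`-element subset of a block of `A`. -/
noncomputable def subspace (A : PiLattice n k) : Submodule ℂ (Fin n → ℂ) :=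
  ⨆ ω ∈ {ω : Finset (Fin n) | ω.card = k ∧ ∃ b ∈ A.1.classes, (ω : Set (Fin n)) ⊆ b},
    blockSubspace ω

/-- The proper part `Π ∖ {0, 1}` of `Π = PiLattice n k`; the homology of the lattice is that of
its proper part. -/
abbrev ProperPart (n k : ℕ) : Type := {C : PiLattice n k // C ≠ ⊥ ∧ C ≠ ⊤}

/-- For `s = {A, B}`: the joins of all sets of atoms, each of which lies below `A` or below `B`. -/
def joinsOfAtoms (s : Set (PiLattice n k)) : Set (PiLattice n k) :=
  {C | ∃ τ : Set (PiLattice n k), (∀ a ∈ τ, IsAtom a ∧ ∃ A ∈ s, a ≤ A) ∧ C = sSup τ}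

/-- The poset `Π_{A,B}` for `s = {A, B}` with `A ∨ B = 1`: the joins of atoms below `A` or `B`,
without `0` and `1`, as a subposet of the proper part of `Π`. -/
def pairPoset (s : Set (PiLattice n k)) : Set (ProperPart n k) :=
  {C | C.1 ∈ joinsOfAtoms s}

/-- The index set of the direct sum: the sets `{A, B}` of one-block partitions with `A ∨ B = 1`
and `A ∩ B = 0`, the latter as subspaces of `ℂⁿ`. -/
abbrev Pairs (n k : ℕ) : Type :=
  {s : Set (PiLattice n k) // ∃ A B : PiLattice n k, s = {A, B} ∧ IsOneBlock A ∧ IsOneBlock B ∧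
    A ⊔ B = ⊤ ∧ subspace A ⊓ subspace B = ⊥}

open Classical in
/-- The homomorphism `ξₚ : ⨁_{A,B} H̃ₚ(Π_{A,B}; R) → H̃ₚ(Π; R)` induced by the embeddings. -/
noncomputable def xi (R : Type*) [CommRing R] (n k : ℕ) (p : ℤ) :
    (DirectSum (Pairs n k) fun s => RedHomology R (pairPoset s.1) p) →ₗ[R]
      RedHomology R (ProperPart n k) p :=
  DirectSum.toModule R (Pairs n k) _ fun s =>
    redHomologyMap R (OrderEmbedding.subtype (· ∈ pairPoset s.1)) p

end KEqual

/-!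
Every cycle of an open interval `(d, 1)` in sufficiently low degree is, modulo boundaries, a sum
of cycles in the posets `Π_s` of the pairs `s = {A, B}`. The proof is a downward induction on `d`.

Fix a point `i` in a trivial block of `d` and let `c` be the partition whose only trivial block is
`{i}`. The elements of `(d, 1)` whose meet with `c` lies strictly above `d` form an acyclic poset
`Q`; the others are covers `e` of `d`, which are attached to `Q` one at a time. Attaching `e` adds
the cones with apex `e` over the cycles of its link `(e, 1)`. By induction these are spanned by
cycles in posets `Π_s`, and each of them already bounds in `Q ∩ Π_s`, so that the cone over it can
be closed to a cycle in `Π_s`.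

For `d ≠ 0` one point `j` of a non-trivial block of `d` is kept fixed, and only pairs whose
non-trivial blocks meet exactly in `j` are used. The induction ends when `d` has at least two
blocks, all non-trivial: then every element above `d` lies in `Π_s` for the pair `s` given by the
block of `j` and by the union of `{j}` with the other blocks.
-/

namespace PosetHomology

variable {X : Type*} [PartialOrder X] (R : Type*) [CommRing R]

open Classical in
/-- The sign with which the flag `s` without its element `a` occurs in the boundary of `s`. -/
noncomputable def FinFlag.sign (s : FinFlag X) (a : X) : R :=
  (-1) ^ (s.1.filter (· < a)).card

theorem FinFlag.sign_mul_self (s : FinFlag X) (a : X) : s.sign R a * s.sign R a = 1 := by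
  rw [FinFlag.sign, ← mul_pow, neg_mul_neg, one_mul, one_pow]

theorem FinFlag.sign_erase_self (s : FinFlag X) (a : X) : (s.erase a).sign R a = s.sign R a := by
  classical
  rw [FinFlag.sign, FinFlag.sign, FinFlag.erase, Finset.filter_erase, Finset.erase_eq_of_notMem]
  simp

theorem FinFlag.sign_mul_sign_erase {s : FinFlag X} {a b : X} (ha : a ∈ s.1) (hb : b ∈ s.1)
    (hab : a ≠ b) :
    s.sign R a * (s.erase a).sign R b = -(s.sign R b * (s.erase b).sign R a) := by
  classical
  wlog hlt : a < b generalizing a b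
  · have hba : b < a := ((s.2.total ha hb).resolve_left fun h => hlt (h.lt_of_ne hab)).lt_of_ne
      hab.symm
    rw [this hb ha hab.symm hba, neg_neg]
  have h_above : s.sign R b = -(s.erase a).sign R b := by
    rw [FinFlag.sign, FinFlag.sign, FinFlag.erase, Finset.filter_erase,
      ← Finset.card_erase_add_one (Finset.mem_filter.2 ⟨ha, hlt⟩), pow_succ, mul_neg_one]
  have h_below : (s.erase b).sign R a = s.sign R a := by
    rw [FinFlag.sign, FinFlag.sign, FinFlag.erase, Finset.filter_erase, Finset.erase_eq_of_notMem]
    simp [hlt.not_gt]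
  rw [h_above, h_below, neg_mul, neg_neg, mul_comm]

/-- A flag is compatible with `y` if adding `y` to it gives a flag. -/
def FinFlag.Compat (s : FinFlag X) (y : X) : Prop := ∀ x ∈ s.1, x ≤ y ∨ y ≤ x

open Classical in
/-- The flag obtained from `s` by adding a compatible element `y`. -/
noncomputable def FinFlag.insert (s : FinFlag X) (y : X) (h : s.Compat y) : FinFlag X :=
  ⟨Insert.insert y s.1, by
    rw [Finset.coe_insert]
    exact s.2.insert fun b hb _ => (h b hb).symm⟩

theorem FinFlag.Compat.erase {s : FinFlag X} {y : X} (h : s.Compat y) (a : X) :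
    (s.erase a).Compat y := by
  classical exact fun x hx => h x (Finset.mem_of_mem_erase hx)

theorem FinFlag.compat_of_mem {s : FinFlag X} {y : X} (hy : y ∈ s.1) : s.Compat y :=
  fun _ hx => s.2.total hx hy

theorem FinFlag.insert_erase {s : FinFlag X} {y : X} (hy : y ∈ s.1) (h : (s.erase y).Compat y) :
    (s.erase y).insert y h = s := by
  classical exact Subtype.ext (Finset.insert_erase hy)

theorem FinFlag.erase_insert {s : FinFlag X} {y : X} (hy : y ∉ s.1) (h : s.Compat y) :
    (s.insert y h).erase y = s := by
  classical exact Subtype.ext (Finset.erase_insert hy)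

open Classical in
/-- The signed insertion of `y` into a flag; it is zero if `y` already belongs to the flag or
is not compatible with it. -/
noncomputable def insertFlag (y : X) (s : FinFlag X) : FinFlag X →₀ R :=
  if h : s.Compat y ∧ y ∉ s.1 then s.sign R y • Finsupp.single (s.insert y h.1) 1 else 0

/-- The linear extension of `insertFlag` to chains: the join with the vertex `y`. -/
noncomputable def insertChain (y : X) : (FinFlag X →₀ R) →ₗ[R] (FinFlag X →₀ R) :=
  Finsupp.linearCombination R (insertFlag R y)

theorem insertFlag_of_mem {y : X} {s : FinFlag X} (h : y ∈ s.1) : insertFlag R y s = 0 :=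
  dif_neg fun hy => hy.2 h

theorem insertFlag_erase_self {y : X} {s : FinFlag X} (hy : y ∈ s.1) :
    insertFlag R y (s.erase y) = s.sign R y • Finsupp.single s 1 := by
  classical
  rw [insertFlag, dif_pos ⟨(FinFlag.compat_of_mem hy).erase y, Finset.notMem_erase y s.1⟩,
    FinFlag.insert_erase hy, FinFlag.sign_erase_self]

theorem insertChain_single (y : X) (s : FinFlag X) :
    insertChain R y (Finsupp.single s 1) = insertFlag R y s := by
  rw [insertChain, Finsupp.linearCombination_single, one_smul]

theorem boundary_single (s : FinFlag X) :
    boundary R X (Finsupp.single s 1) =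
      ∑ a ∈ s.1, s.sign R a • Finsupp.single (s.erase a) 1 := by
  simp [boundary, FinFlag.sign]

theorem boundary_boundary_single (s : FinFlag X) :
    boundary R X (boundary R X (Finsupp.single s 1)) = 0 := by
  classical
  simp only [boundary_single, map_sum, map_smul, Finset.smul_sum, smul_smul]
  rw [Finset.sum_sigma']
  refine Finset.sum_involution (fun p _ => ⟨p.2, p.1⟩) ?_ ?_ ?_ fun _ _ => rfl
  · rintro ⟨a, b⟩ hab
    obtain ⟨ha, hba⟩ := Finset.mem_sigma.1 hab
    obtain ⟨hne, hb⟩ := Finset.mem_erase.1 hba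
    have hswap : (s.erase a).erase b = (s.erase b).erase a := Subtype.ext Finset.erase_right_comm
    rw [hswap, FinFlag.sign_mul_sign_erase R ha hb hne.symm, neg_smul, neg_add_cancel]
  · rintro ⟨a, b⟩ hab - heq
    exact (Finset.mem_erase.1 (Finset.mem_sigma.1 hab).2).1 (congrArg Sigma.fst heq)
  · rintro ⟨a, b⟩ hab
    obtain ⟨ha, hba⟩ := Finset.mem_sigma.1 hab
    obtain ⟨hne, hb⟩ := Finset.mem_erase.1 hba
    exact Finset.mem_sigma.2 ⟨hb, Finset.mem_erase.2 ⟨hne.symm, ha⟩⟩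

theorem boundary_boundary (z : FinFlag X →₀ R) : boundary R X (boundary R X z) = 0 := by
  suffices h : boundary R X ∘ₗ boundary R X = 0 from LinearMap.congr_fun h z
  exact Finsupp.lhom_ext' fun s => LinearMap.ext_ring (boundary_boundary_single R s)

theorem insertChain_boundary_single_of_mem {y : X} {s : FinFlag X} (hy : y ∈ s.1) :
    insertChain R y (boundary R X (Finsupp.single s 1)) = Finsupp.single s 1 := by
  classical
  simp only [boundary_single, map_sum, map_smul, insertChain_single]
  rw [Finset.sum_eq_single_of_mem y hy]
  · rw [insertFlag_erase_self R hy, smul_smul, FinFlag.sign_mul_self, one_smul]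
  · intro a _ hay
    rw [insertFlag_of_mem R (s := s.erase a) (Finset.mem_erase.2 ⟨hay.symm, hy⟩), smul_zero]

theorem boundary_insertFlag_erase_self {y : X} {s : FinFlag X} (hy : y ∈ s.1) :
    boundary R X (insertFlag R y (s.erase y)) +
      insertChain R y (boundary R X (Finsupp.single (s.erase y) 1)) =
        Finsupp.single (s.erase y) 1 := by
  classical
  rw [insertFlag_erase_self R hy, map_smul]
  simp only [boundary_single, map_sum, map_smul, insertChain_single]
  rw [← Finset.add_sum_erase _ _ hy, smul_add, smul_smul, FinFlag.sign_mul_self, one_smul,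
    add_assoc, add_eq_left, Finset.smul_sum]
  refine (Finset.sum_add_distrib).symm.trans (Finset.sum_eq_zero fun a ha => ?_)
  obtain ⟨hay, has⟩ := Finset.mem_erase.1 ha
  have hswap : (s.erase y).erase a = (s.erase a).erase y := Subtype.ext Finset.erase_right_comm
  rw [hswap, insertFlag_erase_self R (s := s.erase a) (Finset.mem_erase.2 ⟨hay.symm, hy⟩),
    smul_smul, smul_smul, ← add_smul]
  have hsign := FinFlag.sign_mul_sign_erase R hy has hay.symm
  have hcancel : s.sign R y * s.sign R a + (s.erase y).sign R a * (s.erase a).sign R y = 0 := by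
    linear_combination (s.erase y).sign R a * s.sign R a * hsign -
      s.sign R y * s.sign R a * (s.erase y).sign_mul_self R a -
      (s.erase y).sign R a * (s.erase a).sign R y * s.sign_mul_self R a
  rw [hcancel, zero_smul]

theorem boundary_insertFlag_of_compat {y : X} {s : FinFlag X} (hs : s.Compat y) :
    boundary R X (insertFlag R y s) + insertChain R y (boundary R X (Finsupp.single s 1)) =
      Finsupp.single s 1 := by
  classical
  by_cases hy : y ∈ s.1
  · rw [insertFlag_of_mem R hy, map_zero, zero_add, insertChain_boundary_single_of_mem R hy]
  · have h := boundary_insertFlag_erase_self R (s := s.insert y hs) (Finset.mem_insert_self y s.1)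
    rwa [FinFlag.erase_insert hy] at h

theorem supported_le_comap_iff {R α M : Type*} [Semiring R] [AddCommMonoid M] [Module R M]
    {f : (α →₀ R) →ₗ[R] M} {N : Submodule R M} {A : Set α} :
    Finsupp.supported R R A ≤ N.comap f ↔ ∀ a ∈ A, f (Finsupp.single a 1) ∈ N := by
  rw [Finsupp.supported_eq_span_single, Submodule.span_le, Set.image_subset_iff]
  rfl

theorem boundary_insertChain_add {y : X} {z : FinFlag X →₀ R}
    (hz : z ∈ Finsupp.supported R R {s : FinFlag X | s.Compat y}) :
    boundary R X (insertChain R y z) + insertChain R y (boundary R X z) = z := by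
  have hzero := (supported_le_comap_iff (f := boundary R X ∘ₗ insertChain R y +
    insertChain R y ∘ₗ boundary R X - LinearMap.id) (N := ⊥)).2 (fun s hs => by
      rw [Submodule.mem_bot, LinearMap.sub_apply, LinearMap.add_apply, LinearMap.comp_apply,
        LinearMap.comp_apply, insertChain_single, boundary_insertFlag_of_compat R hs,
        LinearMap.id_apply, sub_self]) hz
  exact sub_eq_zero.1 hzero

/-! ### Cycles and boundaries of a set of elements -/

/-- The flags with `q` elements, all in `U`. -/
def flagsIn (U : Set X) (q : ℤ) : Set (FinFlag X) :=
  {s | (s.1 : Set X) ⊆ U ∧ (s.1.card : ℤ) = q}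

/-- The chains of flags in `U`. The degree `q` is the number of elements of a flag, one more than
the dimension of the simplex. -/
noncomputable def flagChains (U : Set X) (q : ℤ) : Submodule R (FinFlag X →₀ R) :=
  Finsupp.supported R R (flagsIn U q)

/-- The reduced cycles in `flagChains R U q`. -/
noncomputable def flagCycles (U : Set X) (q : ℤ) : Submodule R (FinFlag X →₀ R) :=
  flagChains R U q ⊓ LinearMap.ker (boundary R X)

/-- The boundaries in `flagChains R U q` of chains in `U`. -/
noncomputable def flagBoundaries (U : Set X) (q : ℤ) : Submodule R (FinFlag X →₀ R) :=
  (flagChains R U (q + 1)).map (boundary R X)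

variable {R} {U V W : Set X} {q : ℤ}

theorem flagsIn_mono (h : U ⊆ V) (q : ℤ) : flagsIn U q ⊆ flagsIn V q :=
  fun _ hs => ⟨hs.1.trans h, hs.2⟩

theorem flagChains_mono (h : U ⊆ V) (q : ℤ) : flagChains R U q ≤ flagChains R V q :=
  Finsupp.supported_mono (flagsIn_mono h q)

theorem flagCycles_mono (h : U ⊆ V) (q : ℤ) : flagCycles R U q ≤ flagCycles R V q :=
  inf_le_inf_right _ (flagChains_mono h q)

theorem flagBoundaries_mono (h : U ⊆ V) (q : ℤ) : flagBoundaries R U q ≤ flagBoundaries R V q :=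
  Submodule.map_mono (flagChains_mono h _)

theorem flagChains_le_comap_boundary (U : Set X) (q : ℤ) :
    flagChains R U (q + 1) ≤ (flagChains R U q).comap (boundary R X) := by
  classical
  refine supported_le_comap_iff.2 fun s hs => ?_
  rw [boundary_single]
  refine Submodule.sum_mem _ fun a ha => Submodule.smul_mem _ _ <|
    Finsupp.single_mem_supported R _ ⟨fun x hx => hs.1 (Finset.mem_of_mem_erase hx), ?_⟩
  have hcard : (s.erase a).1.card + 1 = s.1.card := Finset.card_erase_add_one ha
  have hs_card := hs.2
  omega

theorem flagChains_le_comap_insertChain {y : X} (hy : y ∈ U) (q : ℤ) :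
    flagChains R U q ≤ (flagChains R U (q + 1)).comap (insertChain R y) := by
  classical
  refine supported_le_comap_iff.2 fun s hs => ?_
  rw [insertChain_single, insertFlag]
  split_ifs with h
  · refine Submodule.smul_mem _ _ (Finsupp.single_mem_supported R _ ⟨?_, ?_⟩)
    · intro x hx
      rcases Finset.mem_insert.1 hx with rfl | hx
      exacts [hy, hs.1 hx]
    · rw [FinFlag.insert, Finset.card_insert_of_notMem h.2, Nat.cast_succ, hs.2]
  · exact Submodule.zero_mem _

theorem boundary_insertChain_add_of_comparable {y : X} (hy : ∀ x ∈ U, x ≤ y ∨ y ≤ x)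
    {z : FinFlag X →₀ R} (hz : z ∈ flagChains R U q) :
    boundary R X (insertChain R y z) + insertChain R y (boundary R X z) = z :=
  boundary_insertChain_add R <|
    Finsupp.supported_mono (fun s (hs : s ∈ flagsIn U q) x hx => hy x (hs.1 hx)) hz

theorem flagBoundaries_le_flagCycles (U : Set X) (q : ℤ) :
    flagBoundaries R U q ≤ flagCycles R U q := by
  rintro _ ⟨w, hw, rfl⟩
  exact ⟨flagChains_le_comap_boundary U q hw, boundary_boundary R w⟩

theorem flagCycles_eq_bot_of_neg (U : Set X) (hq : q < 0) : flagCycles R U q = ⊥ := by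
  have hempty : flagsIn U q = ∅ :=
    Set.eq_empty_of_forall_notMem fun s hs => by have := hs.2; omega
  rw [flagCycles, flagChains, hempty, Finsupp.supported_empty, bot_inf_eq]

theorem flagCycles_le_sup {K : Submodule R (FinFlag X →₀ R)}
    (hK : K ≤ LinearMap.ker (boundary R X)) (h : flagCycles R V q ≤ flagChains R U q ⊔ K) :
    flagCycles R V q ≤ flagCycles R U q ⊔ K :=
  calc flagCycles R V q ≤ (flagChains R U q ⊔ K) ⊓ LinearMap.ker (boundary R X) :=
        le_inf h inf_le_right
    _ = flagCycles R U q ⊔ K := by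
        rw [sup_comm, sup_inf_assoc_of_le _ hK, sup_comm, flagCycles]

theorem flagChains_insert_le (x : X) (U : Set X) (q : ℤ) :
    flagChains R (insert x U) q ≤
      flagChains R U q ⊔ Finsupp.supported R R (flagsIn (insert x U) q ∩ {s | x ∈ s.1}) := by
  rw [flagChains, flagChains, ← Finsupp.supported_union]
  refine Finsupp.supported_mono fun s hs => ?_
  by_cases hx : x ∈ s.1
  · exact Or.inr ⟨hs, hx⟩
  · exact Or.inl ⟨fun w hw => (hs.1 hw).resolve_left fun h => hx (h ▸ hw), hs.2⟩

theorem flagCycles_le_flagBoundaries_of_cone {a : X} (ha : a ∈ U) (h : ∀ x ∈ U, x ≤ a ∨ a ≤ x)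
    (q : ℤ) : flagCycles R U q ≤ flagBoundaries R U q := by
  intro z hz
  refine ⟨insertChain R a z, flagChains_le_comap_insertChain ha q hz.1, ?_⟩
  have hhom := boundary_insertChain_add_of_comparable h hz.1
  rwa [LinearMap.mem_ker.1 hz.2, map_zero, add_zero] at hhom

theorem insertChain_boundary_mem_flagChains {y : X} (hy : y ∈ U) {z : FinFlag X →₀ R}
    (hz : z ∈ flagChains R U q) : insertChain R y (boundary R X z) ∈ flagChains R U q := by
  obtain ⟨p, rfl⟩ : ∃ p, q = p + 1 := ⟨q - 1, by omega⟩
  exact flagChains_le_comap_insertChain hy p (flagChains_le_comap_boundary U p hz)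

theorem flagCycles_insert_le_of_isGreatest {x y : X} (h : IsGreatest (U ∩ Set.Iio x) y) (q : ℤ) :
    flagCycles R (insert x U) q ≤ flagCycles R U q ⊔ flagBoundaries R (insert x U) q := by
  refine flagCycles_le_sup ((flagBoundaries_le_flagCycles _ q).trans inf_le_right) fun z hz => ?_
  obtain ⟨u, hu, w, hw, rfl⟩ := Submodule.mem_sup.1 (flagChains_insert_le x U q hz.1)
  have h_through : ∀ s ∈ flagsIn (insert x U) q ∩ {s | x ∈ s.1}, s.Compat y := by
    rintro s ⟨hs, hxs⟩ v hv
    rcases s.2.total hv hxs with hvx | hxv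
    · rcases hvx.eq_or_lt with rfl | hvx
      · exact Or.inr h.1.2.le
      · exact Or.inl (h.2 ⟨(hs.1 hv).resolve_left hvx.ne, hvx⟩)
    · exact Or.inr (h.1.2.le.trans hxv)
  have hw_split := boundary_insertChain_add R (Finsupp.supported_mono h_through hw)
  have hw_boundary : boundary R X w = -boundary R X u :=
    eq_neg_of_add_eq_zero_right ((map_add _ u w).symm.trans hz.2)
  rw [← hw_split, hw_boundary, map_neg, add_comm _ (-_), ← add_assoc, ← sub_eq_add_neg]
  refine Submodule.add_mem_sup
    (Submodule.sub_mem _ hu (insertChain_boundary_mem_flagChains h.1.1 hu)) ⟨_, ?_, rfl⟩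
  exact flagChains_le_comap_insertChain (Set.mem_insert_of_mem x h.1.1) q
    (Finsupp.supported_mono Set.inter_subset_left hw)

theorem flagCycles_le_flagBoundaries_of_isGreatest {a : X} (hU : U.Finite) (ha : a ∈ U)
    (h : ∀ x ∈ U, ∃ y, IsGreatest {w ∈ U | w ≤ x ∧ w ≤ a} y) (q : ℤ) :
    flagCycles R U q ≤ flagBoundaries R U q := by
  induction hm : U.ncard using Nat.strong_induction_on generalizing U with
  | _ m ih =>
  by_cases hall : ∀ x ∈ U, x ≤ a
  · exact flagCycles_le_flagBoundaries_of_cone ha (fun x hx => Or.inl (hall x hx)) q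
  push Not at hall
  obtain ⟨x, ⟨hxU, hxa⟩, hxmin⟩ :=
    (hU.subset (Set.sep_subset U (¬ · ≤ a))).exists_minimal hall
  have h_below : ∀ w ∈ U, w < x → w ≤ a := fun w hw hwx =>
    by_contra fun hwa => hwx.not_ge (hxmin ⟨hw, hwa⟩ hwx.le)
  obtain ⟨y, ⟨hyU, hyx, hya⟩, hy⟩ := h x hxU
  have hyx : y < x := hyx.lt_of_ne fun e => hxa (e ▸ hya)
  have h_greatest : IsGreatest (U \ {x} ∩ Set.Iio x) y :=
    ⟨⟨⟨hyU, hyx.ne⟩, hyx⟩, fun w hw => hy ⟨hw.1.1, hw.2.le, h_below w hw.1.1 hw.2⟩⟩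
  have h_rest : flagCycles R (U \ {x}) q ≤ flagBoundaries R (U \ {x}) q := by
    refine ih _ (hm ▸ Set.ncard_sdiff_singleton_lt_of_mem hxU hU) (hU.subset Set.sdiff_subset)
      ⟨ha, fun e => hxa (e ▸ le_rfl)⟩ (fun w hw => ?_) rfl
    obtain ⟨v, ⟨hvU, hvw, hva⟩, hv_max⟩ := h w hw.1
    have hvx : v ≠ x := fun e => hxa (e ▸ hva)
    exact ⟨v, ⟨⟨hvU, hvx⟩, hvw, hva⟩, fun u hu => hv_max ⟨hu.1.1, hu.2⟩⟩
  have h_remove := flagCycles_insert_le_of_isGreatest (R := R) h_greatest q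
  rw [Set.insert_sdiff_self_of_mem hxU] at h_remove
  exact h_remove.trans (sup_le (h_rest.trans (flagBoundaries_mono Set.sdiff_subset q)) le_rfl)

/-- The chains generated by boundaries in `V` and by cycles in the sets `V ∩ M s` with `s ∈ S`.
Every cycle in `V` is one of them exactly when the homology of `V` is spanned by that of its
subposets `V ∩ M s`. -/
noncomputable def spannedCycles {ι : Type*} (R : Type*) [CommRing R] (M : ι → Set X) (S : Set ι)
    (V : Set X) (q : ℤ) : Submodule R (FinFlag X →₀ R) :=
  flagBoundaries R V q ⊔ ⨆ s ∈ S, flagCycles R (V ∩ M s) q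

section Spanned

variable {ι : Type*} {M : ι → Set X} {S T : Set ι}

theorem spannedCycles_le_ker (M : ι → Set X) (S : Set ι) (V : Set X) (q : ℤ) :
    spannedCycles R M S V q ≤ LinearMap.ker (boundary R X) :=
  sup_le ((flagBoundaries_le_flagCycles V q).trans inf_le_right)
    (iSup₂_le fun _ _ => inf_le_right)

theorem flagCycles_inter_le_spannedCycles (V : Set X) (q : ℤ) {s : ι} (hs : s ∈ S) :
    flagCycles R (V ∩ M s) q ≤ spannedCycles R M S V q :=
  le_sup_of_le_right (le_iSup₂_of_le s hs le_rfl)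

theorem flagCycles_insert_le_of_minimal {e : X} (he : e ∉ U) (hmin : ∀ x ∈ U, ¬ x < e) (q : ℤ) :
    flagCycles R (insert e U) (q + 1) ≤
      flagChains R U (q + 1) ⊔ (flagCycles R (U ∩ Set.Ioi e) q).map (insertChain R e) := by
  intro z hz
  obtain ⟨u, hu, w, hw, rfl⟩ := Submodule.mem_sup.1 (flagChains_insert_le e U (q + 1) hz.1)
  have hw_above : w ∈ flagChains R (Set.Ici e) (q + 1) := by
    refine Finsupp.supported_mono ?_ hw
    rintro s ⟨hs, hes⟩
    refine ⟨fun x hx => ?_, hs.2⟩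
    rcases s.2.total hes hx with hex | hxe
    · exact hex
    · rcases hs.1 hx with rfl | hxU
      · exact le_rfl
      · exact (hxe.eq_of_not_lt (hmin x hxU)).ge
  have hw_cone : insertChain R e (boundary R X w) = w := by
    have hzero : insertChain R e w = 0 := supported_le_comap_iff (N := ⊥).2
      (fun s hs => by rw [insertChain_single, insertFlag_of_mem R hs.2]; exact zero_mem _) hw
    have hhom := boundary_insertChain_add_of_comparable (fun _ hx => Or.inr hx) hw_above
    rwa [hzero, map_zero, zero_add] at hhom
  have hw_boundary : boundary R X w = -boundary R X u :=
    eq_neg_of_add_eq_zero_right ((map_add _ u w).symm.trans hz.2)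
  refine Submodule.add_mem_sup hu ⟨boundary R X w, ⟨?_, boundary_boundary R w⟩, hw_cone⟩
  have hU : boundary R X w ∈ flagChains R U q :=
    hw_boundary ▸ Submodule.neg_mem _ (flagChains_le_comap_boundary U q hu)
  intro s hs
  refine ⟨fun x hx => ⟨(hU hs).1 hx, ?_⟩, (hU hs).2⟩
  refine ((flagChains_le_comap_boundary _ q hw_above hs).1 hx).lt_of_ne ?_
  rintro rfl
  exact he ((hU hs).1 hx)

theorem map_insertChain_flagBoundaries_le {e : X} (he : e ∈ V) (hWV : W ⊆ V)
    (hW : ∀ x ∈ W, e ≤ x) (q : ℤ) :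
    (flagBoundaries R W q).map (insertChain R e) ≤
      flagChains R W (q + 1) ⊔ flagBoundaries R V (q + 1) := by
  rintro _ ⟨_, ⟨u, hu, rfl⟩, rfl⟩
  have hhom := boundary_insertChain_add_of_comparable (fun x hx => Or.inr (hW x hx)) hu
  rw [eq_sub_of_add_eq' hhom]
  exact Submodule.sub_mem _ (Submodule.mem_sup_left hu) (Submodule.mem_sup_right
    ⟨_, flagChains_le_comap_insertChain he _ (flagChains_mono hWV _ hu), rfl⟩)

-- A cycle `c = ∂ b` gives the cycle `e * c - b`.
theorem map_insertChain_flagCycles_le {e : X} (he : e ∈ V) (hWV : W ⊆ V)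
    (hW : ∀ x ∈ W, e ≤ x) (hUV : U ⊆ V) (h : flagCycles R W q ≤ flagBoundaries R U q) :
    (flagCycles R W q).map (insertChain R e) ≤
      flagChains R U (q + 1) ⊔ flagCycles R V (q + 1) := by
  rintro _ ⟨c, hc, rfl⟩
  obtain ⟨b, hb, hbc⟩ := h hc
  have hhom := boundary_insertChain_add_of_comparable (fun x hx => Or.inr (hW x hx)) hc.1
  rw [LinearMap.mem_ker.1 hc.2, map_zero, add_zero] at hhom
  rw [← add_sub_cancel b (insertChain R e c)]
  refine Submodule.add_mem_sup hb ⟨Submodule.sub_mem _ ?_ (flagChains_mono hUV _ hb), ?_⟩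
  · exact flagChains_le_comap_insertChain he q (flagChains_mono hWV q hc.1)
  · exact LinearMap.mem_ker.2 (by rw [map_sub, hhom, hbc, sub_self])

theorem flagCycles_insert_le_sup_spannedCycles {e : X} (hUV : U ⊆ V) (heV : e ∈ V) (heU : e ∉ U)
    (hmin : ∀ x ∈ V, ¬ x < e) (hQU : V ∩ Set.Ioi e ⊆ U) (hTS : T ⊆ S)
    (hspan : flagCycles R (V ∩ Set.Ioi e) q ≤ spannedCycles R M T (V ∩ Set.Ioi e) q)
    (hbd : ∀ s ∈ T, e ∈ M s ∧
      flagCycles R (V ∩ Set.Ioi e ∩ M s) q ≤ flagBoundaries R (U ∩ M s) q) :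
    flagCycles R (insert e U) (q + 1) ≤
      flagCycles R U (q + 1) ⊔ spannedCycles R M S V (q + 1) := by
  refine flagCycles_le_sup (spannedCycles_le_ker M S V _) <|
    (flagCycles_insert_le_of_minimal heU (fun x hx => hmin x (hUV hx)) q).trans <|
    sup_le le_sup_left ?_
  refine (Submodule.map_mono ((flagCycles_mono (Set.inter_subset_inter_left _ hUV) q).trans
    hspan)).trans ?_
  simp only [spannedCycles, Submodule.map_sup, Submodule.map_iSup]
  refine sup_le ?_ (iSup₂_le fun s hs => ?_)
  · refine (map_insertChain_flagBoundaries_le heV Set.inter_subset_left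
      (fun x hx => hx.2.le) q).trans ?_
    exact sup_le_sup (flagChains_mono hQU _) le_sup_left
  · refine (map_insertChain_flagCycles_le (V := V ∩ M s) ⟨heV, (hbd s hs).1⟩
      (Set.inter_subset_inter_left _ Set.inter_subset_left) (fun x hx => hx.1.2.le)
      (Set.inter_subset_inter_left _ hUV) (hbd s hs).2).trans ?_
    exact sup_le_sup (flagChains_mono Set.inter_subset_left _)
      (flagCycles_inter_le_spannedCycles V _ (hTS hs))

theorem flagCycles_le_spannedCycles_of_minimal {Q : Set X} (hQV : Q ⊆ V) (hfin : (V \ Q).Finite)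
    (hmin : ∀ e ∈ V \ Q, ∀ x ∈ V, ¬ x < e)
    (hQ : flagCycles R Q (q + 1) ≤ spannedCycles R M S V (q + 1))
    (hlink : ∀ e ∈ V \ Q, ∃ T ⊆ S,
      flagCycles R (V ∩ Set.Ioi e) q ≤ spannedCycles R M T (V ∩ Set.Ioi e) q ∧
      ∀ s ∈ T, e ∈ M s ∧
        flagCycles R (V ∩ Set.Ioi e ∩ M s) q ≤ flagBoundaries R (Q ∩ M s) q) :
    flagCycles R V (q + 1) ≤ spannedCycles R M S V (q + 1) := by
  suffices h : ∀ E ⊆ V \ Q, flagCycles R (Q ∪ E) (q + 1) ≤ spannedCycles R M S V (q + 1) by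
    simpa only [Set.union_sdiff_cancel hQV] using h _ subset_rfl
  intro E hE
  induction E, hfin.subset hE using Set.Finite.induction_on with
  | empty => rwa [Set.union_empty]
  | @insert e E heE _ ih =>
    obtain ⟨he, hE⟩ := Set.insert_subset_iff.1 hE
    obtain ⟨T, hTS, hspan, hbd⟩ := hlink e he
    have h_above : V ∩ Set.Ioi e ⊆ Q := fun x hx =>
      by_contra fun hxQ => hmin x ⟨hx.1, hxQ⟩ e he.1 hx.2
    rw [Set.union_insert]
    refine (flagCycles_insert_le_sup_spannedCycles
      (Set.union_subset hQV (hE.trans Set.sdiff_subset)) he.1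
      (fun h => h.elim he.2 heE) (hmin e he) (h_above.trans Set.subset_union_left) hTS hspan
      fun s hs => ⟨(hbd s hs).1, (hbd s hs).2.trans (flagBoundaries_mono
        (Set.inter_subset_inter_left _ Set.subset_union_left) q)⟩).trans ?_
    exact sup_le (ih hE) le_rfl

end Spanned

/-! ### Open intervals of a finite lattice -/

/-- The elements of `J` below `⊤` that meet `c` strictly above `d`, within `J`. They form the
acyclic part of the interval `(d, ⊤)` to which the remaining elements are attached. -/
def meetingAbove {L : Type*} [PartialOrder L] [OrderTop L] (J : Set L) (c d : L) : Set L :=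
  {x ∈ J | x < ⊤ ∧ ∃ z ∈ J, d < z ∧ z ≤ x ∧ z ≤ c}

section Lattice

variable {L : Type*} [CompleteLattice L] [Finite L]

theorem flagCycles_meetingAbove_le_flagBoundaries {J : Set L} (hJ : SupClosed J) {c d : L}
    (hc : c < ⊤) (hJc : ∃ z ∈ J, d < z ∧ z ≤ c) (q : ℤ) :
    flagCycles R (meetingAbove J c d) q ≤ flagBoundaries R (meetingAbove J c d) q := by
  have h_core : ∀ x, (∃ z ∈ J, d < z ∧ z ≤ x ∧ z ≤ c) →
      ∃ y, IsGreatest {z ∈ J | d < z ∧ z ≤ x ∧ z ≤ c} y := by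
    rintro x ⟨z, hz⟩
    have hmem : sSup {z ∈ J | d < z ∧ z ≤ x ∧ z ≤ c} ∈ J :=
      hJ.sSup_mem_of_nonempty (Set.toFinite _) ⟨z, hz⟩ fun _ hw => hw.1
    exact ⟨_, ⟨hmem, hz.2.1.trans_le (le_sSup hz), sSup_le fun _ hw => hw.2.2.1,
      sSup_le fun _ hw => hw.2.2.2⟩, fun _ hw => le_sSup hw⟩
  have h_mem : ∀ x y, IsGreatest {z ∈ J | d < z ∧ z ≤ x ∧ z ≤ c} y → y ∈ meetingAbove J c d :=
    fun x y hy => ⟨hy.1.1, hy.1.2.2.2.trans_lt hc, y, hy.1.1, hy.1.2.1, le_rfl, hy.1.2.2.2⟩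
  obtain ⟨a, ha⟩ := h_core ⊤ (by simpa using hJc)
  refine flagCycles_le_flagBoundaries_of_isGreatest (Set.toFinite _) (h_mem ⊤ a ha) ?_ q
  rintro x ⟨-, -, hx⟩
  obtain ⟨y, hy⟩ := h_core x hx
  refine ⟨y, ⟨h_mem x y hy, hy.1.2.2.1, ha.2 ⟨hy.1.1, hy.1.2.1, le_top, hy.1.2.2.2⟩⟩, ?_⟩
  rintro w ⟨⟨hwJ, -, z, -, hdz, hzw, -⟩, hwx, hwa⟩
  exact hy.2 ⟨hwJ, hdz.trans_le hzw, hwx, hwa.trans ha.1.2.2.2⟩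

theorem flagCycles_Ioo_le_spannedCycles_of_covBy {ι : Type*} {M : ι → Set L}
    (hM : ∀ s, SupClosed (M s)) {S : Set ι} {c d : L} (hdc : d < c) (hc : c < ⊤)
    (hcov : ∀ e, d < e → e < ⊤ → ¬ d < e ⊓ c → d ⋖ e) {q : ℤ}
    (hlink : ∀ e, d ⋖ e → e < ⊤ → ¬ e ≤ c → ∃ T ⊆ S,
      flagCycles R (Set.Ioo e ⊤) q ≤ spannedCycles R M T (Set.Ioo e ⊤) q ∧
      ∀ s ∈ T, e ∈ M s ∧ ⊤ ∈ M s ∧ ∀ x ∈ M s, e < x → ∃ z ∈ M s, d < z ∧ z ≤ x ∧ z ≤ c) :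
    flagCycles R (Set.Ioo d ⊤) (q + 1) ≤ spannedCycles R M S (Set.Ioo d ⊤) (q + 1) := by
  have hQ_sub : meetingAbove Set.univ c d ⊆ Set.Ioo d ⊤ :=
    fun x ⟨_, hx, z, _, hdz, hzx, _⟩ => ⟨hdz.trans_le hzx, hx⟩
  have h_cover : ∀ e ∈ Set.Ioo d ⊤ \ meetingAbove Set.univ c d, d ⋖ e ∧ ¬ e ≤ c := by
    refine fun e ⟨he, heQ⟩ => ⟨hcov e he.1 he.2 fun h => heQ ?_, fun hec => heQ ?_⟩
    · exact ⟨Set.mem_univ e, he.2, e ⊓ c, Set.mem_univ _, h, inf_le_left, inf_le_right⟩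
    · exact ⟨Set.mem_univ e, he.2, e, Set.mem_univ e, he.1, le_rfl, hec⟩
  refine flagCycles_le_spannedCycles_of_minimal hQ_sub (Set.toFinite _)
    (fun e he x hx => (h_cover e he).1.2 hx.1) ?_ fun e he => ?_
  · exact (flagCycles_meetingAbove_le_flagBoundaries (fun _ _ _ _ => Set.mem_univ _) hc
      ⟨c, Set.mem_univ c, hdc, le_rfl⟩ _).trans
      ((flagBoundaries_mono hQ_sub _).trans le_sup_left)
  · obtain ⟨T, hTS, hspan, hT⟩ := hlink e (h_cover e he).1 he.1.2 (h_cover e he).2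
    have h_above : Set.Ioo d ⊤ ∩ Set.Ioi e = Set.Ioo e ⊤ :=
      Set.ext fun x => ⟨fun hx => ⟨hx.2, hx.1.2⟩, fun hx => ⟨⟨he.1.1.trans hx.1, hx.2⟩, hx.1⟩⟩
    rw [h_above]
    refine ⟨T, hTS, hspan, fun s hs => ?_⟩
    obtain ⟨heM, htop, hmeet⟩ := hT s hs
    obtain ⟨z, hzM, hdz, -, hzc⟩ := hmeet ⊤ htop he.1.2
    have h_link_sub : Set.Ioo e ⊤ ∩ M s ⊆ meetingAbove (M s) c d :=
      fun x hx => ⟨hx.2, hx.1.2, hmeet x hx.2 hx.1.1⟩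
    have h_sub_Q : meetingAbove (M s) c d ⊆ meetingAbove Set.univ c d ∩ M s :=
      fun x ⟨hxM, hx, z, _, hz⟩ => ⟨⟨Set.mem_univ x, hx, z, Set.mem_univ z, hz⟩, hxM⟩
    exact ⟨heM, (flagCycles_mono h_link_sub q).trans <|
      (flagCycles_meetingAbove_le_flagBoundaries (hM s) hc ⟨z, hzM, hdz, hzc⟩ q).trans
        (flagBoundaries_mono h_sub_Q q)⟩

end Lattice

/-! ### Induced maps on homology -/

section Transport

variable {P Q : Type*} [PartialOrder P] [PartialOrder Q]

theorem FinFlag.map_injective (f : P ↪o Q) : Function.Injective (FinFlag.map f) := fun _ _ h =>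
  Subtype.ext (Finset.map_injective f.toEmbedding (congrArg Subtype.val h))

theorem FinFlag.image_map_eq_flagsIn (f : P ↪o Q) (q : ℤ) :
    FinFlag.map f '' {s | (s.1.card : ℤ) = q} = flagsIn (Set.range f) q := by
  ext t
  constructor
  · rintro ⟨s, hs, rfl⟩
    refine ⟨fun x hx => ?_, (congrArg Nat.cast (Finset.card_map _)).trans hs⟩
    obtain ⟨a, -, rfl⟩ := Finset.mem_map.1 hx
    exact ⟨a, rfl⟩
  · rintro ⟨ht, hcard⟩
    obtain ⟨u, hu⟩ : ∃ u : Finset P, u.map f.toEmbedding = t.1 := by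
      classical
      obtain ⟨u, -, hu⟩ := Finset.subset_set_image_iff.1 (Set.image_univ.symm ▸ ht)
      exact ⟨u, (Finset.map_eq_image _ _).trans hu⟩
    refine ⟨⟨u, fun a ha b hb _ => ?_⟩, ?_, Subtype.ext hu⟩
    · have hmem : ∀ {c}, c ∈ u → f c ∈ t.1 := fun hc => hu ▸ Finset.mem_map_of_mem f.toEmbedding hc
      exact (t.2.total (hmem ha) (hmem hb)).imp f.le_iff_le.1 f.le_iff_le.1
    · rwa [← hu, Finset.card_map] at hcard

theorem chainMap_injective (f : P ↪o Q) : Function.Injective (chainMap R f) :=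
  Finsupp.mapDomain_injective (FinFlag.map_injective f)

theorem chainMap_trans {T : Type*} [PartialOrder T] (f : P ↪o Q) (g : Q ↪o T) :
    chainMap R (f.trans g) = chainMap R g ∘ₗ chainMap R f := by
  rw [chainMap, chainMap, chainMap, ← Finsupp.lmapDomain_comp]
  congr 1
  exact funext fun s => Subtype.ext (Finset.map_map _ _ _).symm

theorem map_chains (f : P ↪o Q) (p : ℤ) :
    (chains R P p).map (chainMap R f) = flagChains R (Set.range f) (p + 1) := by
  rw [chains, chainMap, Finsupp.lmapDomain_supported, FinFlag.image_map_eq_flagsIn, flagChains]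

theorem map_cycles (f : P ↪o Q) (p : ℤ) :
    (cycles R P p).map (chainMap R f) = flagCycles R (Set.range f) (p + 1) := by
  have hker : LinearMap.ker (boundary R P) =
      (LinearMap.ker (boundary R Q)).comap (chainMap R f) := by
    ext z
    rw [Submodule.mem_comap, LinearMap.mem_ker, LinearMap.mem_ker, ← chainMap_boundary,
      map_eq_zero_iff _ (chainMap_injective f)]
  rw [cycles, hker, ← Submodule.map_inf_eq_map_inf_comap, map_chains, flagCycles]

theorem map_boundaries (f : P ↪o Q) (p : ℤ) :
    (boundaries R P p).map (chainMap R f) = flagBoundaries R (Set.range f) (p + 1) := by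
  rw [flagBoundaries, ← map_chains, boundaries, ← Submodule.map_comp, ← Submodule.map_comp]
  exact congrArg (Submodule.map · _) (LinearMap.ext (chainMap_boundary R f))

theorem boundaries_le_cycles (P : Type*) [PartialOrder P] (p : ℤ) :
    boundaries R P p ≤ cycles R P p := by
  let f : P ↪o P := (OrderIso.refl P).toOrderEmbedding
  rw [← Submodule.map_le_map_iff_of_injective (chainMap_injective f), map_cycles, map_boundaries]
  exact flagBoundaries_le_flagCycles _ _

set_option maxSynthPendingDepth 10 in
/-- The projection from reduced cycles to reduced homology. -/
noncomputable def homologyClass (R : Type*) [CommRing R] (P : Type*) [PartialOrder P] (p : ℤ) :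
    cycles R P p →ₗ[R] RedHomology R P p :=
  Submodule.mkQ ((boundaries R P p).submoduleOf (cycles R P p))

set_option maxSynthPendingDepth 10 in
theorem homologyClass_surjective (p : ℤ) : Function.Surjective (homologyClass R P p) :=
  Submodule.mkQ_surjective _

set_option maxSynthPendingDepth 10 in
theorem homologyClass_eq_zero {p : ℤ} {z : cycles R P p} (hz : z.1 ∈ boundaries R P p) :
    homologyClass R P p z = 0 :=
  (Submodule.Quotient.mk_eq_zero _).2 hz

theorem redHomologyMap_homologyClass (f : P ↪o Q) {p : ℤ} (z : cycles R P p) :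
    redHomologyMap R f p (homologyClass R P p z) = homologyClass R Q p (cyclesMap R f p z) :=
  rfl

theorem iSup_range_redHomologyMap_eq_top {ι : Type*} {P : ι → Type*} [∀ i, PartialOrder (P i)]
    {f : ∀ i, P i ↪o Q} {p : ℤ}
    (h : cycles R Q p ≤
      boundaries R Q p ⊔ ⨆ i, (cycles R (P i) p).map (chainMap R (f i))) :
    ⨆ i, LinearMap.range (redHomologyMap R (f i) p) = ⊤ := by
  set N := ⨆ i, LinearMap.range (redHomologyMap R (f i) p)
  suffices hN : cycles R Q p ≤
      (N.comap (homologyClass R Q p)).map (cycles R Q p).subtype by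
    rw [eq_top_iff]
    rintro c -
    obtain ⟨z, rfl⟩ := homologyClass_surjective p c
    obtain ⟨w, hw, hwz⟩ := hN z.2
    exact Subtype.ext hwz ▸ hw
  refine h.trans (sup_le (fun b hb => ?_) (iSup_le fun i => ?_))
  · refine ⟨⟨b, boundaries_le_cycles Q p hb⟩, ?_, rfl⟩
    exact Submodule.mem_comap.2 ((homologyClass_eq_zero (z := ⟨b, _⟩) hb).symm ▸ zero_mem N)
  · rintro _ ⟨w, hw, rfl⟩
    refine ⟨cyclesMap R (f i) p ⟨w, hw⟩, ?_, rfl⟩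
    exact Submodule.mem_iSup_of_mem i
      ⟨homologyClass R (P i) p ⟨w, hw⟩, redHomologyMap_homologyClass (f i) _⟩

end Transport

end PosetHomology

namespace KEqual

open PosetHomology

variable {n k : ℕ}

/-! ### Partitions and their atoms -/

namespace PiLattice

variable {r t : PiLattice n k} {i x y : Fin n} {S : Set (Fin n)}

/-- The block of the partition `r` that contains `x`. -/
def block (r : PiLattice n k) (x : Fin n) : Set (Fin n) := {y | r.1 x y}

instance : Finite (PiLattice n k) :=
  Finite.of_injective (block (n := n) (k := k)) fun _ _ h =>
    Subtype.ext (Setoid.ext fun x _ => Set.ext_iff.1 (congrFun h x) _)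

/-- The union of the non-trivial blocks of `r`. -/
def support (r : PiLattice n k) : Set (Fin n) := {x | ∃ y, y ≠ x ∧ r.1 x y}

theorem mem_block_self (r : PiLattice n k) (x : Fin n) : x ∈ r.block x := r.1.refl x

theorem block_mono (h : r ≤ t) (x : Fin n) : r.block x ⊆ t.block x := fun _ hy => h hy

theorem support_mono (h : r ≤ t) : r.support ⊆ t.support := fun _ ⟨y, hy, hxy⟩ => ⟨y, hy, h hxy⟩

theorem eq_of_notMem_support (hx : x ∉ r.support) (hxy : r.1 x y) : y = x :=
  by_contra fun hne => hx ⟨y, hne, hxy⟩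

theorem block_subset_support (hx : x ∈ r.support) : r.block x ⊆ r.support := fun y hxy => by
  by_cases hne : y = x
  exacts [hne ▸ hx, ⟨x, Ne.symm hne, r.1.symm hxy⟩]

theorem block_eq_class (r : Setoid (Fin n)) (x : Fin n) : {y | r x y} = {y | r y x} :=
  Set.ext fun _ => ⟨r.symm, r.symm⟩

theorem le_ncard_block (hx : x ∈ r.support) : k ≤ (r.block x).ncard := by
  obtain ⟨y, hyx, hxy⟩ := hx
  rw [block, block_eq_class]
  refine (r.2 _ ⟨x, rfl⟩).resolve_left fun hone => hyx ?_
  exact (Set.ncard_le_one_iff (Set.toFinite _)).1 hone.le (r.1.symm hxy) (r.1.refl x)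

theorem blocks_of_le_ncard {r : Setoid (Fin n)}
    (h : ∀ x y, y ≠ x → r x y → k ≤ {z | r x z}.ncard) :
    ∀ b ∈ r.classes, b.ncard = 1 ∨ k ≤ b.ncard := by
  rintro b ⟨x, rfl⟩
  rw [← block_eq_class]
  by_cases hx : ∃ y, y ≠ x ∧ r x y
  · obtain ⟨y, hyx, hxy⟩ := hx
    exact Or.inr (h x y hyx hxy)
  · push Not at hx
    refine Or.inl (Set.ncard_eq_one.2 ⟨x, Set.Subset.antisymm ?_ ?_⟩)
    · exact fun y hxy => by_contra fun hyx => hx y hyx hxy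
    · exact Set.singleton_subset_iff.2 (r.refl x)

theorem support_eq_empty_iff : r.support = ∅ ↔ r = ⊥ := by
  constructor
  · intro h
    refine le_bot_iff.1 fun x y hxy => ?_
    rw [eq_of_notMem_support (h ▸ Set.notMem_empty x) hxy]
  · rintro rfl
    have hle : (⊥ : PiLattice n k) ≤ ⟨⊥, blocks_of_le_ncard fun _ _ hne h => (hne h.symm).elim⟩ :=
      bot_le
    exact Set.eq_empty_of_forall_notMem fun x ⟨y, hyx, hxy⟩ => hyx (hle hxy).symm

theorem support_nonempty (h : r ≠ ⊥) : r.support.Nonempty :=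
  Set.nonempty_iff_ne_empty.2 fun hr => h (support_eq_empty_iff.1 hr)

/-- The partition with the block `S` and all other blocks trivial. -/
def oneBlock (S : Set (Fin n)) (hS : k ≤ S.ncard) : PiLattice n k :=
  ⟨⟨fun x y => x = y ∨ (x ∈ S ∧ y ∈ S), fun _ => Or.inl rfl,
    fun h => h.imp Eq.symm And.symm, by
      rintro x y z (rfl | h) (rfl | h')
      · exact Or.inl rfl
      · exact Or.inr h'
      · exact Or.inr h
      · exact Or.inr ⟨h.1, h'.2⟩⟩,
    blocks_of_le_ncard fun x y hne h =>
      hS.trans (Set.ncard_le_ncard fun _ hz => Or.inr ⟨(h.resolve_left hne.symm).1, hz⟩)⟩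

theorem oneBlock_le_iff {hS : k ≤ S.ncard} : oneBlock S hS ≤ r ↔ ∀ x ∈ S, S ⊆ r.block x := by
  refine ⟨fun h x hx y hy => h (Or.inr ⟨hx, hy⟩), fun h x y hxy => ?_⟩
  rcases hxy with rfl | ⟨hx, hy⟩
  exacts [r.1.refl x, h x hx hy]

theorem oneBlock_le_of_subset_block {hS : k ≤ S.ncard} (h : S ⊆ r.block x) : oneBlock S hS ≤ r :=
  oneBlock_le_iff.2 fun _ hu _ hv => r.1.trans (r.1.symm (h hu)) (h hv)

theorem support_oneBlock (hk : 2 ≤ k) (hS : k ≤ S.ncard) : (oneBlock S hS).support = S := by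
  ext x
  constructor
  · rintro ⟨y, hyx, hxy⟩
    exact (hxy.resolve_left hyx.symm).1
  · intro hx
    obtain ⟨y, hy, hyx⟩ := Set.exists_ne_of_one_lt_ncard (by omega : 1 < S.ncard) x
    exact ⟨y, hyx, Or.inr ⟨hx, hy⟩⟩

theorem oneBlock_ne_bot (hk : 2 ≤ k) (hS : k ≤ S.ncard) : oneBlock S hS ≠ ⊥ := by
  have hne : S.Nonempty := Set.nonempty_of_ncard_ne_zero (by omega)
  rw [Ne, ← support_eq_empty_iff, support_oneBlock hk hS]
  exact hne.ne_empty

/-- The greatest partition in which `i` forms a trivial block. -/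
def isolate (i : Fin n) (hi : k ≤ ({i}ᶜ : Set (Fin n)).ncard) : PiLattice n k := oneBlock {i}ᶜ hi

theorem le_isolate_iff {hi : k ≤ ({i}ᶜ : Set (Fin n)).ncard} :
    r ≤ isolate i hi ↔ i ∉ r.support := by
  constructor
  · rintro h ⟨y, hyi, hiy⟩
    exact ((h hiy).resolve_left hyi.symm).1 rfl
  · intro h x y hxy
    by_cases hxi : x = i
    · subst hxi
      exact Or.inl (eq_of_notMem_support h hxy).symm
    by_cases hyi : y = i
    · subst hyi
      exact Or.inl (eq_of_notMem_support h (r.1.symm hxy))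
    exact Or.inr ⟨hxi, hyi⟩

theorem top_rel (hkn : k ≤ n) (x y : Fin n) : (⊤ : PiLattice n k).1 x y := by
  have hle : oneBlock (k := k) (Set.univ : Set (Fin n)) (by simpa [Set.ncard_univ]) ≤ ⊤ := le_top
  exact oneBlock_le_iff.1 hle x trivial trivial

theorem isolate_lt_top (hk : 2 ≤ k) (hi : k ≤ ({i}ᶜ : Set (Fin n)).ncard) : isolate i hi < ⊤ := by
  have hcard : ({i}ᶜ : Set (Fin n)).ncard ≤ n := by
    simpa using Set.ncard_le_card ({i}ᶜ : Set (Fin n))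
  obtain ⟨y, -, hyi⟩ := Set.exists_ne_of_one_lt_ncard
    (by simp [Set.ncard_univ]; omega : 1 < (Set.univ : Set (Fin n)).ncard) i
  refine lt_top_iff_ne_top.2 fun h => le_isolate_iff.1 (le_refl (isolate i hi)) ?_
  exact h ▸ ⟨y, hyi, top_rel (hi.trans hcard) i y⟩

theorem isAtom_oneBlock (hk : 2 ≤ k) (hS : S.ncard = k) : IsAtom (oneBlock S hS.ge) := by
  refine ⟨oneBlock_ne_bot hk _, fun r hr => by_contra fun hne => hr.not_ge ?_⟩
  obtain ⟨x, hx⟩ := support_nonempty hne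
  have hxS : x ∈ S := support_oneBlock hk hS.ge ▸ support_mono hr.le hx
  have hsub : r.block x ⊆ S := fun y hxy => by
    rcases hr.le hxy with rfl | h
    exacts [hxS, h.2]
  exact oneBlock_le_of_subset_block
    (Set.eq_of_subset_of_ncard_le hsub (hS ▸ le_ncard_block hx)).ge

theorem le_of_isAtom (hk : 2 ≤ k) (ht : IsAtom t) (hx : x ∈ t.support)
    (h : t.block x ⊆ r.block x) : t ≤ r := by
  have hle : oneBlock (t.block x) (le_ncard_block hx) ≤ t := oneBlock_le_of_subset_block subset_rfl
  rw [← (ht.le_iff.1 hle).resolve_left (oneBlock_ne_bot hk _)]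
  exact oneBlock_le_of_subset_block h

theorem exists_isAtom_le (hk : 2 ≤ k) (hxy : r.1 x y) (hne : x ≠ y) :
    ∃ t, IsAtom t ∧ t ≤ r ∧ t.1 x y := by
  have hpair : {x, y} ⊆ r.block x := Set.pair_subset (r.1.refl x) hxy
  obtain ⟨T, hT_pair, hT_block, hT⟩ := Set.exists_subsuperset_card_eq hpair
    ((Set.ncard_pair hne).trans_le hk) (le_ncard_block ⟨y, hne.symm, hxy⟩)
  exact ⟨oneBlock T hT.ge, isAtom_oneBlock hk hT, oneBlock_le_of_subset_block hT_block,
    Or.inr ⟨hT_pair (by simp), hT_pair (by simp)⟩⟩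

theorem le_of_forall_isAtom_le (hk : 2 ≤ k) (h : ∀ a, IsAtom a → a ≤ r → a ≤ t) : r ≤ t := by
  intro x y hxy
  by_cases hne : x = y
  · exact hne ▸ t.1.refl x
  · obtain ⟨a, ha, har, haxy⟩ := exists_isAtom_le hk hxy hne
    exact h a ha har haxy

theorem le_ncard_sdiff_singleton {β : Set (Fin n)} (hi : i ∈ r.support) (hβ : r.block i ⊂ β) :
    k ≤ (β \ {i}).ncard := by
  rw [Set.ncard_sdiff_singleton_of_mem (hβ.subset (r.mem_block_self i))]
  exact Nat.le_sub_one_of_lt ((le_ncard_block hi).trans_lt (Set.ncard_lt_ncard hβ))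

theorem not_oneBlock_sdiff_singleton_le {β : Set (Fin n)} (hi : i ∈ r.support)
    (hβ : r.block i ⊂ β) (hcard : k ≤ (β \ {i}).ncard) : ¬ oneBlock (β \ {i}) hcard ≤ r := by
  intro hle
  obtain ⟨w, hwi, hiw⟩ := hi
  refine hβ.not_subset fun y hy => ?_
  by_cases hyi : y = i
  · exact hyi ▸ r.mem_block_self i
  · exact r.1.trans hiw (oneBlock_le_iff.1 hle w ⟨hβ.subset hiw, hwi⟩ ⟨hy, hyi⟩)

end PiLattice

open PiLattice

section JoinsOfAtoms

variable {s : Set (PiLattice n k)} {d e x : PiLattice n k} {i : Fin n}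

theorem mem_joinsOfAtoms_iff : x ∈ joinsOfAtoms s ↔
    ∀ y, (∀ t, IsAtom t → (∃ A ∈ s, t ≤ A) → t ≤ x → t ≤ y) → x ≤ y := by
  constructor
  · rintro ⟨τ, hτ, rfl⟩ y hy
    exact sSup_le fun t ht => hy t (hτ t ht).1 (hτ t ht).2 (le_sSup ht)
  · intro h
    exact ⟨{t | IsAtom t ∧ (∃ A ∈ s, t ≤ A) ∧ t ≤ x}, fun a ha => ⟨ha.1, ha.2.1⟩,
      le_antisymm (h _ fun t ht hts htx => le_sSup ⟨ht, hts, htx⟩) (sSup_le fun t ht => ht.2.2)⟩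

theorem exists_isAtom_not_le (hx : x ∈ joinsOfAtoms s) (hxe : ¬ x ≤ e) :
    ∃ t, IsAtom t ∧ (∃ A ∈ s, t ≤ A) ∧ t ≤ x ∧ ¬ t ≤ e := by
  by_contra! hall
  exact hxe (mem_joinsOfAtoms_iff.1 hx e hall)

theorem supClosed_joinsOfAtoms (s : Set (PiLattice n k)) : SupClosed (joinsOfAtoms s) :=
  fun _ hx _ hy => mem_joinsOfAtoms_iff.2 fun z hz => sup_le
    (mem_joinsOfAtoms_iff.1 hx z fun t ht hts htx => hz t ht hts (le_sup_of_le_left htx))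
    (mem_joinsOfAtoms_iff.1 hy z fun t ht hts hty => hz t ht hts (le_sup_of_le_right hty))

/-- Every block of `d` lies in a block of some member of `s`: a property passing to refinements
of `d` and forcing `d` to be a join of atoms below members of `s`. -/
def IsSubordinate (s : Set (PiLattice n k)) (d : PiLattice n k) : Prop :=
  ∀ x, ∃ A ∈ s, d.block x ⊆ A.block x

theorem IsSubordinate.mono (h : IsSubordinate s e) (hde : d ≤ e) : IsSubordinate s d := fun x =>
  let ⟨A, hA, hx⟩ := h x
  ⟨A, hA, (block_mono hde x).trans hx⟩

theorem IsSubordinate.of_le {A : PiLattice n k} (hA : A ∈ s) (h : d ≤ A) : IsSubordinate s d :=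
  fun x => ⟨A, hA, block_mono h x⟩

theorem IsSubordinate.mem_joinsOfAtoms (hk : 2 ≤ k) (h : IsSubordinate s d) :
    d ∈ joinsOfAtoms s :=
  mem_joinsOfAtoms_iff.2 fun _ hD => le_of_forall_isAtom_le hk fun t ht htd => by
    obtain ⟨x, hx⟩ := support_nonempty ht.1
    obtain ⟨A, hA, hxA⟩ := h x
    exact hD t ht ⟨A, hA, le_of_isAtom hk ht hx ((block_mono htd x).trans hxA)⟩ htd

-- If an atom below `x` but not below `e` involves `i`, it enlarges the block of `i`, and the
-- enlarged block remains large enough when `i` is removed from it.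
theorem exists_joinsOfAtoms_not_le (hk : 2 ≤ k) (hi : {A ∈ s | i ∈ A.support}.Subsingleton)
    (hei : i ∈ e.support) (hse : IsSubordinate s e) (hx : x ∈ joinsOfAtoms s) (hex : e < x) :
    ∃ z ∈ joinsOfAtoms s, z ≤ x ∧ i ∉ z.support ∧ ¬ z ≤ e := by
  obtain ⟨t, ht, ⟨A, hA, htA⟩, htx, hte⟩ := exists_isAtom_not_le hx hex.not_ge
  by_cases hti : i ∈ t.support
  · obtain ⟨F, hF, hFe⟩ := hse i
    have hFi : i ∈ F.support := hei.imp fun y hy => ⟨hy.1, hFe hy.2⟩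
    obtain rfl : A = F := hi ⟨hA, support_mono htA hti⟩ ⟨hF, hFi⟩
    have hβ : e.block i ⊂ x.block i ∩ A.block i := by
      refine ⟨Set.subset_inter (block_mono hex.le i) hFe, fun hsub => hte ?_⟩
      exact le_of_isAtom hk ht hti
        ((Set.subset_inter (block_mono htx i) (block_mono htA i)).trans hsub)
    have hcard := le_ncard_sdiff_singleton hei hβ
    refine ⟨oneBlock _ hcard, (IsSubordinate.of_le hA ?_).mem_joinsOfAtoms hk, ?_, ?_,
      not_oneBlock_sdiff_singleton_le hei hβ hcard⟩
    · exact oneBlock_le_of_subset_block (Set.sdiff_subset.trans Set.inter_subset_right)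
    · exact oneBlock_le_of_subset_block (Set.sdiff_subset.trans Set.inter_subset_left)
    · rw [support_oneBlock hk]
      exact fun h => h.2 rfl
  · exact ⟨t, (IsSubordinate.of_le hA htA).mem_joinsOfAtoms hk, htx, hti, hte⟩

theorem exists_joinsOfAtoms_le_isolate (hk : 2 ≤ k) {hi : k ≤ ({i}ᶜ : Set (Fin n)).ncard}
    (hs : {A ∈ s | i ∈ A.support}.Subsingleton) (hdi : d ≤ isolate i hi) (hde : d ≤ e)
    (hei : i ∈ e.support) (hse : IsSubordinate s e) (hx : x ∈ joinsOfAtoms s) (hex : e < x) :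
    ∃ z ∈ joinsOfAtoms s, d < z ∧ z ≤ x ∧ z ≤ isolate i hi := by
  obtain ⟨z, hz, hzx, hzi, hze⟩ := exists_joinsOfAtoms_not_le hk hs hei hse hx hex
  exact ⟨d ⊔ z, supClosed_joinsOfAtoms s ((hse.mono hde).mem_joinsOfAtoms hk) hz,
    left_lt_sup.2 fun h => hze (h.trans hde), sup_le (hde.trans hex.le) hzx,
    sup_le hdi (le_isolate_iff.2 hzi)⟩

theorem covBy_of_not_lt_inf_isolate (hk : 2 ≤ k) {hi : k ≤ ({i}ᶜ : Set (Fin n)).ncard}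
    (hd : d ≤ isolate i hi) (hde : d < e) (he : ¬ d < e ⊓ isolate i hi) : d ⋖ e := by
  refine ⟨hde, fun x hdx hxe => he ?_⟩
  by_cases hxi : i ∈ x.support
  · have h_all : ∀ y : PiLattice n k, IsSubordinate {⊤} y := fun y =>
      IsSubordinate.of_le (Set.mem_singleton ⊤) le_top
    obtain ⟨z, -, hdz, hze, hzi⟩ := exists_joinsOfAtoms_le_isolate hk (s := {⊤})
      (Set.subsingleton_singleton.anti (Set.sep_subset _ _)) hd hdx.le hxi (h_all x)
      ((h_all e).mem_joinsOfAtoms hk) hxe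
    exact hdz.trans_le (le_inf hze hzi)
  · exact hdx.trans_le (le_inf hxe.le (le_isolate_iff.2 hxi))

variable {R : Type*} [CommRing R]

theorem flagCycles_Ioo_le_spannedCycles_of_isolate (hk : 2 ≤ k)
    {hi : k ≤ ({i}ᶜ : Set (Fin n)).ncard} (hd : d < isolate i hi) {S : Set (Set (PiLattice n k))}
    (hS : ∀ s ∈ S, ⊤ ∈ joinsOfAtoms s) {q : ℤ}
    (hlink : ∀ e, d ⋖ e → e < ⊤ → i ∈ e.support → ∃ T ⊆ S,
      (∀ s ∈ T, IsSubordinate s e ∧ {A ∈ s | i ∈ A.support}.Subsingleton) ∧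
      flagCycles R (Set.Ioo e ⊤) q ≤ spannedCycles R joinsOfAtoms T (Set.Ioo e ⊤) q) :
    flagCycles R (Set.Ioo d ⊤) (q + 1) ≤
      spannedCycles R joinsOfAtoms S (Set.Ioo d ⊤) (q + 1) := by
  refine flagCycles_Ioo_le_spannedCycles_of_covBy supClosed_joinsOfAtoms hd (isolate_lt_top hk hi)
    (fun e hde _ he => covBy_of_not_lt_inf_isolate hk hd.le hde he) fun e hde he hei => ?_
  rw [le_isolate_iff, not_not] at hei
  obtain ⟨T, hTS, hT, hspan⟩ := hlink e hde he hei
  exact ⟨T, hTS, hspan, fun s hs => ⟨(hT s hs).1.mem_joinsOfAtoms hk, hS s (hTS hs),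
    fun x hx hex => exists_joinsOfAtoms_le_isolate hk (hT s hs).2 hd.le hde.le hei (hT s hs).1
      hx hex⟩⟩

end JoinsOfAtoms

/-! ### Pairs of one-block partitions -/

theorem blockSubspace_mono {ω ω' : Finset (Fin n)} (h : ω ⊆ ω') :
    blockSubspace ω ≤ blockSubspace ω' := fun _ hx =>
  ⟨(Finset.sum_subset h fun j _ hj => hx.2 j hj).symm.trans hx.1,
    fun j hj => hx.2 j fun hjω => hj (h hjω)⟩

theorem blockSubspace_inf_eq_bot {ω ω' : Finset (Fin n)} {j : Fin n} (h : ω ∩ ω' ⊆ {j}) :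
    blockSubspace ω ⊓ blockSubspace ω' = ⊥ := by
  rw [eq_bot_iff]
  rintro x ⟨⟨hsum, hω⟩, -, hω'⟩
  have hne : ∀ i, i ≠ j → x i = 0 := fun i hij => by
    by_cases hi : i ∈ ω
    · exact hω' i fun hi' => hij (Finset.mem_singleton.1 (h (Finset.mem_inter.2 ⟨hi, hi'⟩)))
    · exact hω i hi
  have hj : x j = 0 := by
    by_cases hj : j ∈ ω
    · rwa [Finset.sum_eq_single_of_mem j hj fun i _ => hne i] at hsum
    · exact hω j hj
  exact funext fun i => if hij : i = j then hij ▸ hj else hne i hij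

section OneBlock

variable {S T : Set (Fin n)} {j : Fin n} {d x : PiLattice n k}

theorem isOneBlock_oneBlock (hk : 2 ≤ k) (hS : k ≤ S.ncard) : IsOneBlock (oneBlock S hS) := by
  have hclass : ∀ x ∈ S, {y | (oneBlock S hS).1 y x} = S := fun x hx =>
    Set.ext fun y => ⟨fun h => h.elim (· ▸ hx) And.left, fun hy => Or.inr ⟨hy, hx⟩⟩
  obtain ⟨x, hx⟩ := Set.nonempty_of_ncard_ne_zero (by omega : S.ncard ≠ 0)
  refine ⟨S, ⟨⟨x, (hclass x hx).symm⟩, by omega⟩, ?_⟩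
  rintro _ ⟨⟨y, rfl⟩, hb⟩
  refine hclass y (by_contra fun hy => hb (Set.ncard_eq_one.2 ⟨y, Set.ext fun z => ?_⟩))
  exact ⟨fun h => h.resolve_right fun h' => hy h'.2, Or.inl⟩

theorem subspace_oneBlock_le (hk : 2 ≤ k) (hS : k ≤ S.ncard) :
    subspace (oneBlock S hS) ≤ blockSubspace (Set.toFinite S).toFinset := by
  refine iSup₂_le fun ω ⟨hcard, b, ⟨y, hb⟩, hωb⟩ => blockSubspace_mono fun i hi => ?_
  subst hb
  obtain ⟨w, hw, hwi⟩ := Finset.exists_mem_ne (by omega : 1 < ω.card) i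
  have hi_supp : i ∈ (oneBlock S hS).support :=
    ⟨w, hwi, (oneBlock S hS).1.trans (hωb hi) ((oneBlock S hS).1.symm (hωb hw))⟩
  exact (Set.Finite.mem_toFinset _).2 (support_oneBlock hk hS ▸ hi_supp)

theorem subspace_oneBlock_inf_eq_bot (hk : 2 ≤ k) (hS : k ≤ S.ncard) (hT : k ≤ T.ncard)
    (hST : S ∩ T ⊆ {j}) : subspace (oneBlock S hS) ⊓ subspace (oneBlock T hT) = ⊥ := by
  refine le_bot_iff.1 ((inf_le_inf (subspace_oneBlock_le hk hS) (subspace_oneBlock_le hk hT)).trans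
    (blockSubspace_inf_eq_bot (j := j) fun i hi => ?_).le)
  simpa using hST (by simpa using hi)

theorem oneBlock_sup_oneBlock_eq_top (hS : k ≤ S.ncard) (hT : k ≤ T.ncard) (hj : j ∈ S ∩ T)
    (hun : S ∪ T = Set.univ) : oneBlock S hS ⊔ oneBlock T hT = ⊤ := by
  set A := oneBlock S hS ⊔ oneBlock T hT
  have hA : ∀ x, A.1 j x := fun x => by
    rcases hun.ge (Set.mem_univ x) with hx | hx
    · exact (le_sup_left : oneBlock S hS ≤ A) (Or.inr ⟨hj.1, hx⟩)
    · exact (le_sup_right : oneBlock T hT ≤ A) (Or.inr ⟨hj.2, hx⟩)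
  exact top_le_iff.1 fun x y _ => A.1.trans (A.1.symm (hA x)) (hA y)

theorem rel_inf_oneBlock {hS : k ≤ S.ncard} {u v : Fin n} (hu : u ∈ S) (hv : v ∈ S)
    (huv : x.1 u v) (hcard : k ≤ (x.block u ∩ S).ncard) : (x ⊓ oneBlock S hS).1 u v := by
  have hle : oneBlock (x.block u ∩ S) hcard ≤ x ⊓ oneBlock S hS :=
    le_inf (oneBlock_le_of_subset_block Set.inter_subset_left)
      (oneBlock_le_of_subset_block (x := u) fun _ hw => Or.inr ⟨hu, hw.2⟩)
  exact hle (Or.inr ⟨⟨x.mem_block_self u, hu⟩, huv, hv⟩)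

theorem block_subset_insert_compl_block {u : Fin n} (hu : u ∉ d.block j) :
    d.block u ⊆ insert j (d.block j)ᶜ :=
  fun _ huw => Or.inr fun hjw => hu (d.1.trans hjw (d.1.symm huw))

theorem sup_inf_oneBlock_insert_compl_block (hd : d.support = Set.univ)
    (hS : k ≤ (insert j (d.block j)ᶜ).ncard) (hdx : d ≤ x) :
    d ⊔ x ⊓ oneBlock (insert j (d.block j)ᶜ) hS = x := by
  set A := oneBlock (insert j (d.block j)ᶜ) hS
  have h_rep : ∀ u, ∃ v ∈ insert j (d.block j)ᶜ, d.1 u v := fun u => by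
    by_cases hu : u ∈ d.block j
    · exact ⟨j, Or.inl rfl, d.1.symm hu⟩
    · exact ⟨u, Or.inr hu, d.1.refl u⟩
  have h_off : ∀ u ∉ d.block j, ∀ v ∈ insert j (d.block j)ᶜ, x.1 u v → (x ⊓ A).1 u v :=
    fun u hu v hv huv => rel_inf_oneBlock (Or.inr hu) hv huv <|
      (le_ncard_block (hd ▸ Set.mem_univ u)).trans <| Set.ncard_le_ncard <|
        Set.subset_inter (block_mono hdx u) (block_subset_insert_compl_block hu)
  refine le_antisymm (sup_le hdx inf_le_left) fun u v huv => ?_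
  obtain ⟨u', hu', huu'⟩ := h_rep u
  obtain ⟨v', hv', hvv'⟩ := h_rep v
  have huv' : x.1 u' v' := x.1.trans (x.1.symm (hdx huu')) (x.1.trans huv (hdx hvv'))
  have h_mid : (x ⊓ A).1 u' v' := by
    rcases hu' with rfl | hu'
    · rcases hv' with rfl | hv'
      · exact (x ⊓ A).1.refl _
      · exact (x ⊓ A).1.symm (h_off v' hv' _ (Or.inl rfl) (x.1.symm huv'))
    · exact h_off u' hu' v' hv' huv'
  have hd_le : d ≤ d ⊔ x ⊓ A := le_sup_left
  have hA_le : x ⊓ A ≤ d ⊔ x ⊓ A := le_sup_right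
  exact (d ⊔ x ⊓ A).1.trans (hd_le huu')
    ((d ⊔ x ⊓ A).1.trans (hA_le h_mid) ((d ⊔ x ⊓ A).1.symm (hd_le hvv')))

end OneBlock

/-- The pairs of one-block partitions whose non-trivial blocks cover the ground set and have
exactly the point `j` in common. -/
def pairsMeetingAt (k : ℕ) (j : Fin n) : Set (Set (PiLattice n k)) :=
  {s | ∃ (S T : Set (Fin n)) (hS : k ≤ S.ncard) (hT : k ≤ T.ncard),
    S ∩ T = {j} ∧ S ∪ T = Set.univ ∧ s = {oneBlock S hS, oneBlock T hT}}

section PairsMeetingAt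

variable {s : Set (PiLattice n k)} {d e : PiLattice n k} {i j : Fin n}

theorem exists_isOneBlock_of_mem_pairsMeetingAt (hk : 2 ≤ k) (hs : s ∈ pairsMeetingAt k j) :
    ∃ A B : PiLattice n k, s = {A, B} ∧ IsOneBlock A ∧ IsOneBlock B ∧ A ⊔ B = ⊤ ∧
      subspace A ⊓ subspace B = ⊥ := by
  obtain ⟨S, T, hS, hT, hST, hun, rfl⟩ := hs
  exact ⟨_, _, rfl, isOneBlock_oneBlock hk hS, isOneBlock_oneBlock hk hT,
    oneBlock_sup_oneBlock_eq_top hS hT (hST.ge rfl) hun,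
    subspace_oneBlock_inf_eq_bot hk hS hT hST.le⟩

theorem top_mem_joinsOfAtoms_of_mem_pairsMeetingAt (hk : 2 ≤ k) (hs : s ∈ pairsMeetingAt k j) :
    ⊤ ∈ joinsOfAtoms s := by
  obtain ⟨A, B, rfl, -, -, hAB, -⟩ := exists_isOneBlock_of_mem_pairsMeetingAt hk hs
  rw [← hAB]
  exact supClosed_joinsOfAtoms _ ((IsSubordinate.of_le (Or.inl rfl) le_rfl).mem_joinsOfAtoms hk)
    ((IsSubordinate.of_le (Or.inr rfl) le_rfl).mem_joinsOfAtoms hk)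

theorem subsingleton_of_mem_pairsMeetingAt (hk : 2 ≤ k) (hs : s ∈ pairsMeetingAt k j)
    (hij : i ≠ j) : {A ∈ s | i ∈ A.support}.Subsingleton := by
  obtain ⟨S, T, hS, hT, hST, -, rfl⟩ := hs
  have h_disj : i ∈ S → i ∉ T := fun hi hi' => hij (hST.le ⟨hi, hi'⟩)
  rintro A ⟨rfl | rfl, hA⟩ B ⟨rfl | rfl, hB⟩ <;> rw [support_oneBlock hk] at hA hB
  exacts [(h_disj hA hB).elim, (h_disj hB hA).elim]

theorem exists_mem_pairsMeetingAt_of_support_eq_univ (hk : 2 ≤ k) (hd : d.support = Set.univ)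
    (hj : ¬ d.support ⊆ d.block j) : ∃ s ∈ pairsMeetingAt k j, IsSubordinate s d ∧
      ∀ x, d ≤ x → x ∈ joinsOfAtoms s := by
  obtain ⟨w, hw, hwj⟩ := Set.not_subset.1 hj
  have hT : k ≤ (d.block j).ncard := le_ncard_block (hd ▸ Set.mem_univ j)
  have hS : k ≤ (insert j (d.block j)ᶜ).ncard :=
    (le_ncard_block hw).trans (Set.ncard_le_ncard (block_subset_insert_compl_block hwj))
  have hsub : IsSubordinate {oneBlock _ hS, oneBlock _ hT} d := fun x => by
    by_cases hx : x ∈ d.block j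
    · exact ⟨_, Or.inr rfl, fun y hxy => Or.inr ⟨hx, d.1.trans hx hxy⟩⟩
    · exact ⟨_, Or.inl rfl, fun y hxy => Or.inr
        ⟨Or.inr hx, block_subset_insert_compl_block hx hxy⟩⟩
  refine ⟨_, ⟨_, _, hS, hT, ?_, ?_, rfl⟩, hsub, fun x hdx => ?_⟩
  · rw [Set.insert_inter_of_mem (d.mem_block_self j), Set.compl_inter_self, insert_empty_eq]
  · rw [Set.insert_union, Set.compl_union_self, Set.insert_eq_of_mem (Set.mem_univ j)]
  · rw [← sup_inf_oneBlock_insert_compl_block hd hS hdx]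
    exact supClosed_joinsOfAtoms _ (hsub.mem_joinsOfAtoms hk)
      ((IsSubordinate.of_le (Or.inl rfl) inf_le_right).mem_joinsOfAtoms hk)

/-- The partition obtained from `d` by moving the point `i` of a trivial block to the block
of `j`, encoded as the pullback of `d` along the map sending `i` to `j`. -/
def absorb (d : PiLattice n k) (hi : i ∉ d.support) (hj : j ∈ d.support) : PiLattice n k :=
  ⟨Setoid.comap (Function.update id i j) d.1, blocks_of_le_ncard fun x y hyx hxy => by
    have h_update : ∀ z, Function.update id i j z = j ∨ Function.update id i j z = z := fun z =>
      if hz : z = i then Or.inl (by rw [hz, Function.update_self])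
      else Or.inr (Function.update_of_ne hz j id)
    have hx : Function.update id i j x ∈ d.support := by
      by_contra hx
      have hyx' : Function.update id i j y = Function.update id i j x :=
        eq_of_notMem_support hx hxy
      have hxj : Function.update id i j x ≠ j := (ne_of_mem_of_not_mem hj hx).symm
      exact hyx (((h_update y).resolve_left (hyx' ▸ hxj)).symm.trans
        (hyx'.trans ((h_update x).resolve_left hxj)))
    refine (le_ncard_block hx).trans (Set.ncard_le_ncard fun z hz => ?_)
    have hzi : z ≠ i := ne_of_mem_of_not_mem (block_subset_support hx hz) hi
    change d.1 _ (Function.update id i j z)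
    rwa [Function.update_of_ne hzi]⟩

theorem lt_absorb (hi : i ∉ d.support) (hj : j ∈ d.support) : d < absorb d hi hj := by
  have hji : j ≠ i := ne_of_mem_of_not_mem hj hi
  refine lt_of_le_of_ne (fun x y hxy => ?_) fun h => hi (h ▸ ⟨j, hji, ?_⟩)
  · change d.1 (Function.update id i j x) (Function.update id i j y)
    by_cases hx : x = i
    · subst hx
      rw [eq_of_notMem_support hi hxy]
    by_cases hy : y = i
    · subst hy
      rw [eq_of_notMem_support hi (d.1.symm hxy)]
    rwa [Function.update_of_ne hx, Function.update_of_ne hy]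
  · change d.1 (Function.update id i j i) (Function.update id i j j)
    rw [Function.update_self, Function.update_of_ne hji]
    exact d.1.refl j

theorem absorb_le (hi : i ∉ d.support) (hj : j ∈ d.support) (hde : d ≤ e) (hij : e.1 i j) :
    absorb d hi hj ≤ e := by
  have h_update : ∀ x, e.1 x (Function.update id i j x) := fun x => by
    by_cases hx : x = i
    · rwa [hx, Function.update_self]
    · rw [Function.update_of_ne hx]
      exact e.1.refl x
  exact fun x y hxy => e.1.trans (h_update x) (e.1.trans (hde hxy) (e.1.symm (h_update y)))

theorem block_subset_insert_of_covBy (hde : d ⋖ e) (hi : i ∉ d.support) (hj : j ∈ d.support)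
    (hij : i ∈ e.block j) : e.block j ⊆ insert i (d.block j) := by
  obtain rfl : absorb d hi hj = e := (hde.eq_or_eq (lt_absorb hi hj).le
    (absorb_le hi hj hde.le (e.1.symm hij))).resolve_left (lt_absorb hi hj).ne'
  refine fun x hjx => or_iff_not_imp_left.2 fun hxi => ?_
  have hjx' : d.1 (Function.update id i j j) (Function.update id i j x) := hjx
  rwa [Function.update_of_ne (ne_of_mem_of_not_mem hj hi), Function.update_of_ne hxi] at hjx'

-- Passing to the link of a cover `e` lowers `q` by one and, unless `e` has a second non-trivial
-- block, the number of trivial blocks by one as well.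
theorem lt_ncard_compl_support_or_of_covBy (hde : d ⋖ e) (hi : i ∉ d.support)
    (hei : i ∈ e.support) (hj : j ∈ d.support) {q : ℤ}
    (h : q + 1 < d.supportᶜ.ncard ∨ ¬ d.support ⊆ d.block j) :
    q < e.supportᶜ.ncard ∨ ¬ e.support ⊆ e.block j := by
  rw [or_iff_not_imp_right, not_not]
  intro he
  have he_sub : e.support ⊆ insert i (d.block j) :=
    he.trans (block_subset_insert_of_covBy hde hi hj (he hei))
  have hd_sub : d.support ⊆ d.block j := fun x hx =>
    (he_sub (support_mono hde.le hx)).resolve_left fun hxi => hi (hxi ▸ hx)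
  have h_compl : d.supportᶜ ⊆ insert i e.supportᶜ := fun x hx =>
    or_iff_not_imp_left.2 fun hxi hxe =>
      hx (block_subset_support hj ((he_sub hxe).resolve_left hxi))
  have h_card := (Set.ncard_le_ncard h_compl).trans (Set.ncard_insert_le i _)
  have hq := h.resolve_right (not_not.2 hd_sub)
  omega

theorem lt_isolate (hk : 2 ≤ k) (hi : i ∉ d.support) (hcard : k ≤ ({i}ᶜ : Set (Fin n)).ncard)
    (hj : j ∈ d.support) (h : 1 < d.supportᶜ.ncard ∨ ¬ d.support ⊆ d.block j) :
    d < isolate i hcard := by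
  refine (le_isolate_iff.2 hi).lt_of_ne ?_
  rintro rfl
  rw [isolate, support_oneBlock hk] at hj h
  rw [compl_compl, Set.ncard_singleton] at h
  exact h.elim (lt_irrefl 1) fun h' => h' fun y hy => Or.inr ⟨hj, hy⟩

variable {R : Type*} [CommRing R]

theorem flagCycles_Ioo_le_spannedCycles_pairsMeetingAt (hk : 2 ≤ k) (hj : j ∈ d.support) {q : ℤ}
    (hq : q + 1 < d.supportᶜ.ncard ∨ ¬ d.support ⊆ d.block j) :
    flagCycles R (Set.Ioo d ⊤) q ≤ spannedCycles R joinsOfAtoms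
      {s ∈ pairsMeetingAt k j | IsSubordinate s d} (Set.Ioo d ⊤) q := by
  induction d using WellFoundedGT.induction generalizing q with
  | _ d ih =>
  rcases lt_or_ge q 0 with hq_neg | hq_nonneg
  · exact (flagCycles_eq_bot_of_neg _ hq_neg).le.trans bot_le
  by_cases hd : d.support = Set.univ
  · rw [hd, Set.compl_univ, Set.ncard_empty, ← hd] at hq
    obtain ⟨s, hs, hsd, hmem⟩ :=
      exists_mem_pairsMeetingAt_of_support_eq_univ hk hd (hq.resolve_left (by simp; omega))
    have h_sub : Set.Ioo d ⊤ ⊆ Set.Ioo d ⊤ ∩ joinsOfAtoms s := fun x hx => ⟨hx, hmem x hx.1.le⟩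
    exact (flagCycles_mono h_sub q).trans (flagCycles_inter_le_spannedCycles _ q ⟨hs, hsd⟩)
  · obtain ⟨i, hi⟩ := (Set.ne_univ_iff_exists_notMem _).1 hd
    have hji : j ≠ i := ne_of_mem_of_not_mem hj hi
    have hcard : k ≤ ({i}ᶜ : Set (Fin n)).ncard :=
      (le_ncard_block hj).trans (Set.ncard_le_ncard fun x hjx =>
        ne_of_mem_of_not_mem (block_subset_support hj hjx) hi)
    obtain ⟨p, rfl⟩ : ∃ p, q = p + 1 := ⟨q - 1, by omega⟩
    refine flagCycles_Ioo_le_spannedCycles_of_isolate hk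
      (lt_isolate hk hi hcard hj (hq.imp_left fun h => by omega))
      (fun s hs => top_mem_joinsOfAtoms_of_mem_pairsMeetingAt hk hs.1) fun e hde _ hei => ?_
    refine ⟨_, fun s hs => ⟨hs.1, hs.2.mono hde.le⟩,
      fun s hs => ⟨hs.2, subsingleton_of_mem_pairsMeetingAt hk hs.1 hji.symm⟩,
      ih e hde.lt (support_mono hde.le hj) ?_⟩
    exact lt_ncard_compl_support_or_of_covBy hde hi hei hj hq

theorem ncard_support_of_isAtom (hk : 2 ≤ k) (he : IsAtom e) : e.support.ncard = k := by
  obtain ⟨x, hx⟩ := support_nonempty he.1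
  obtain ⟨T, hT_block, hT⟩ := Set.exists_subset_card_eq (le_ncard_block hx)
  have heT : oneBlock T hT.ge = e :=
    (he.le_iff.1 (oneBlock_le_of_subset_block hT_block)).resolve_left (oneBlock_ne_bot hk _)
  rw [← heT, support_oneBlock hk, hT]

theorem flagCycles_Ioo_bot_le_spannedCycles (hk : 2 ≤ k) {q : ℤ} (hq : q < (n : ℤ) - k) :
    flagCycles R (Set.Ioo (⊥ : PiLattice n k) ⊤) q ≤
      spannedCycles R joinsOfAtoms (⋃ j, pairsMeetingAt k j) (Set.Ioo ⊥ ⊤) q := by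
  rcases lt_or_ge q 0 with hq_neg | hq_nonneg
  · exact (flagCycles_eq_bot_of_neg _ hq_neg).le.trans bot_le
  have hn : 0 < n := by omega
  have hcard : k ≤ ({⟨0, hn⟩}ᶜ : Set (Fin n)).ncard := by
    rw [Set.ncard_compl, Set.ncard_singleton, Nat.card_eq_fintype_card, Fintype.card_fin]
    omega
  obtain ⟨p, rfl⟩ : ∃ p, q = p + 1 := ⟨q - 1, by omega⟩
  refine flagCycles_Ioo_le_spannedCycles_of_isolate hk
    (bot_lt_iff_ne_bot.2 (oneBlock_ne_bot hk hcard)) (fun s hs => ?_) fun e he _ hei => ?_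
  · obtain ⟨j, hs⟩ := Set.mem_iUnion.1 hs
    exact top_mem_joinsOfAtoms_of_mem_pairsMeetingAt hk hs
  · obtain ⟨j, hji, hij⟩ := hei
    have h_compl : e.supportᶜ.ncard = n - k := by
      rw [Set.ncard_compl, ncard_support_of_isAtom hk (bot_covBy_iff.1 he),
        Nat.card_eq_fintype_card, Fintype.card_fin]
    exact ⟨_, fun s hs => Set.mem_iUnion.2 ⟨j, hs.1⟩,
      fun s hs => ⟨hs.2, subsingleton_of_mem_pairsMeetingAt hk hs.1 hji.symm⟩,
      flagCycles_Ioo_le_spannedCycles_pairsMeetingAt hk ⟨_, hji.symm, e.1.symm hij⟩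
        (Or.inl (by omega))⟩

end PairsMeetingAt

section Transport

variable {R : Type*} [CommRing R]

theorem range_subtype_properPart :
    Set.range (OrderEmbedding.subtype fun C : PiLattice n k => C ≠ ⊥ ∧ C ≠ ⊤) = Set.Ioo ⊥ ⊤ := by
  ext C
  constructor
  · rintro ⟨D, rfl⟩
    exact ⟨bot_lt_iff_ne_bot.2 D.2.1, lt_top_iff_ne_top.2 D.2.2⟩
  · exact fun h => ⟨⟨C, h.1.ne', h.2.ne⟩, rfl⟩

theorem range_subtype_pairPoset (s : Set (PiLattice n k)) :
    Set.range ((OrderEmbedding.subtype (· ∈ pairPoset s)).trans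
      (OrderEmbedding.subtype fun C : PiLattice n k => C ≠ ⊥ ∧ C ≠ ⊤)) =
      Set.Ioo ⊥ ⊤ ∩ joinsOfAtoms s := by
  ext C
  constructor
  · rintro ⟨D, rfl⟩
    exact ⟨⟨bot_lt_iff_ne_bot.2 D.1.2.1, lt_top_iff_ne_top.2 D.1.2.2⟩, D.2⟩
  · exact fun h => ⟨⟨⟨C, h.1.1.ne', h.1.2.ne⟩, h.2⟩, rfl⟩

theorem cycles_properPart_le (hk : 2 ≤ k) {p : ℤ} (hp : p < (n : ℤ) - k - 1) :
    cycles R (ProperPart n k) p ≤ boundaries R (ProperPart n k) p ⊔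
      ⨆ s : Pairs n k, (cycles R (pairPoset s.1) p).map
        (chainMap R (OrderEmbedding.subtype (· ∈ pairPoset s.1))) := by
  have hinj := chainMap_injective (R := R)
    (OrderEmbedding.subtype fun C : PiLattice n k => C ≠ ⊥ ∧ C ≠ ⊤)
  rw [← Submodule.map_le_map_iff_of_injective hinj, map_cycles, range_subtype_properPart,
    Submodule.map_sup, map_boundaries, range_subtype_properPart, Submodule.map_iSup]
  refine (flagCycles_Ioo_bot_le_spannedCycles hk (by omega)).trans
    (sup_le_sup_left (iSup₂_le fun s hs => ?_) _)
  obtain ⟨j, hj⟩ := Set.mem_iUnion.1 hs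
  refine le_iSup_of_le ⟨s, exists_isOneBlock_of_mem_pairsMeetingAt hk hj⟩ ?_
  rw [← Submodule.map_comp, ← chainMap_trans, map_cycles, range_subtype_pairPoset]

theorem range_redHomologyMap_le_range_xi {p : ℤ} (s : Pairs n k) :
    LinearMap.range (redHomologyMap R (OrderEmbedding.subtype (· ∈ pairPoset s.1)) p) ≤
      LinearMap.range (xi R n k p) := by
  classical
  rintro _ ⟨c, rfl⟩
  refine ⟨DirectSum.lof R (Pairs n k) (fun s => RedHomology R (pairPoset s.1) p) s c, ?_⟩
  rw [xi, DirectSum.toModule_lof]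

end Transport

end KEqual

theorem lemma8p1 (R : Type*) [CommRing R] (n k : ℕ) (hk : 2 ≤ k) (hkn : k ≤ n) (p : ℤ)
    (hp : p < (n : ℤ) - (k : ℤ) - 1) :
    Function.Surjective (KEqual.xi R n k p) := by
  rw [← LinearMap.range_eq_top, eq_top_iff,
    ← PosetHomology.iSup_range_redHomologyMap_eq_top (KEqual.cycles_properPart_le hk hp)]
  exact iSup_le KEqual.range_redHomologyMap_le_range_xi
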